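/- All schemes are noetherian. A ring homomorphism $A\to B$ is *localizing* if it exhibits $B$ as $S^{-1}A$ for some multiplicative subset $S\subset A$; it is *essentially of finite type* if $B$ is a localization of a finitely generated $A$-algebra. A map $f\colon X\to Y$ of noetherian schemes is *essentially of finite type* (resp. *localizing*) if every $y\in Y$ has an affine open neighborhood $V=\operatorname{Spec}A$ such that $f^{-1}V$ is covered by finitely many affine open subsets $U_i=\operatorname{Spec}B_i$ for which the corresponding ring homomorphisms $A\to B_i$ are essentially of finite type (resp. localizing). A *localizing immersion* is a localizing map that is injective on underlying sets. The map $f$ is *essentially quasi-finite* if it is essentially of finite type and, for every $y\in Y$, the fiber $X_y$ is isomorphic over the residue field $k(y)$ to $\operatorname{Spec}A$ for some $k(y)$-algebra $A$ of finite dimension as a $k(y)$-vector space. **Theorem (Essential Zariski Main Theorem).** Let $f\colon X\to Y$ be a separated essentially quasi-finite map of noetherian schemes. Then there are a noetherian scheme $Z$, a localizing immersion $i\colon X\to Z$ and a finite map $h\colon Z\to Y$ such that $f=h\circ i$. -/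

import Mathlib

open CategoryTheory AlgebraicGeometry

universe u

namespace EssZMT

/-- A ring homomorphism `φ : A →+* B` is *localizing* if it exhibits `B` as the localization
of `A` at some multiplicative subset. -/
def IsLocalizingHom {A B : Type u} [CommRing A] [CommRing B] (φ : A →+* B) : Prop :=
  ∃ S : Submonoid A, @IsLocalization A _ S B _ φ.toAlgebra

/-- Every point `y` of `Y` has an affine open neighbourhood `V = Spec A` such that `f⁻¹ V` is
covered by finitely many affine opens `U = Spec B` (contained in `f⁻¹ V`) for which the
corresponding ring homomorphism `A → B` has the property `P`. -/
def LocallyOnFiniteAffineCover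
    (P : ∀ {A B : Type u} [CommRing A] [CommRing B], (A →+* B) → Prop)
    {X Y : Scheme.{u}} (f : X ⟶ Y) : Prop :=
  ∀ y : Y, ∃ V : Y.Opens, IsAffineOpen V ∧ y ∈ V ∧
    ∃ s : Set X.Opens, s.Finite ∧ sSup s = f ⁻¹ᵁ V ∧
      ∀ U ∈ s, IsAffineOpen U ∧ ∃ e : U ≤ f ⁻¹ᵁ V, P (f.appLE V U e).hom

/-- Scheme maps (used between noetherian schemes) that are *essentially of finite type*. -/
def IsEssFiniteType {X Y : Scheme.{u}} (f : X ⟶ Y) : Prop :=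
  LocallyOnFiniteAffineCover RingHom.EssFiniteType f

/-- *Localizing* scheme maps (used between noetherian schemes). -/
def IsLocalizing {X Y : Scheme.{u}} (f : X ⟶ Y) : Prop :=
  LocallyOnFiniteAffineCover IsLocalizingHom f

/-- A *localizing immersion* (used between noetherian schemes) is a localizing map that is
injective on underlying sets. -/
structure IsLocalizingImmersion {X Y : Scheme.{u}} (f : X ⟶ Y) : Prop where
  isLocalizing : IsLocalizing f
  injective : Function.Injective (f : X → Y)

/-- The fibre of `f` over `y` is *algebraically finite*: it is isomorphic, over the residue
field `k(y)`, to `Spec A` for a `k(y)`-algebra `A` of finite dimension as a vector space. -/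
def HasAlgebraicallyFiniteFiber {X Y : Scheme.{u}} (f : X ⟶ Y) (y : Y) : Prop :=
  ∃ (A : CommRingCat.{u}) (φ : Y.residueField y ⟶ A) (e : f.fiber y ≅ Spec A),
    φ.hom.Finite ∧ e.hom ≫ Spec.map φ = f.fiberToSpecResidueField y

/-- A scheme map (used between noetherian schemes) is *essentially quasi-finite* if it is
essentially of finite type and all its fibres are algebraically finite. -/
structure IsEssQuasiFinite {X Y : Scheme.{u}} (f : X ⟶ Y) : Prop where
  isEssFiniteType : IsEssFiniteType f
  fiber : ∀ y : Y, HasAlgebraicallyFiniteFiber f y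

end EssZMT

namespace EssZMT

open TopologicalSpace Limits TensorProduct

/-! Local part. Let `V` be an affine open of `Y`, `R = Γ(Y, V)`, `G = Γ(X, f⁻¹ V)`, `A` the integral
closure of `R` in `G`, and `x` a point of a chart `U`. After a base change `R → R'`, étale and then
localized at a prime, the chart acquires a clopen piece that is finite over `R'` and contains a
point above `x` (`exists_flat_isIdempotentElem_finite`). As `f` is separated, this piece `W` is
clopen in the whole base change of `X`, so the section `ε` equal to 1 on `W` and 0 elsewhere makes
every `ε t` integral over `R'`. Sections and integral closure commute with this base change, hence
`ε t` comes from `R' ⊗ A`. Flatness preserves kernels: if `ε` lies in the base change of the kernel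
of a linear map out of `A`, it is a combination of elements of that kernel, and one of them is
nonzero at `x`. Taking restriction to the complement of `U`, and multiplication by `γ` modulo `A`,
gives integral sections `s` nonzero at `x` with `X_s ⊆ U`, respectively with `s γ` integral. So
finitely many integral sections determine `X` near `x`: any subring of `G` containing them and the
image of `R` has some `Γ(X, X_r)`, with `x ∈ X_r`, as a localization
(`exists_finite_isLocalizingHom`).

Global part. Finitely many such sections, over finitely many opens `V`, must be placed in one finite
algebra inside `f_* 𝒪_X`. For a section `s` over `V`, take all integral sections that extend a
multiple of `s` and vanish on a thickened complement `Q` of `f⁻¹ V`. By Artin–Rees, `Q` can be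
chosen so that `f⁻¹ V` and `Q` together detect sections; an extension is then determined by its
multiplier, and noetherianity of `Y` gives finiteness. `Z` is the relative spectrum of the algebra
so generated (`exists_isFinite_factorization`). The sections `r` come from `Z`, so two points with
the same image lie in a common chart `X_r`, on which `X → Z` is a localization and hence injective.
-/

/-! ### Étale-local structure of quasi-finite algebras essentially of finite type. -/

/-- The maps from `R₁` and `C` to the residue field of `P₁` invert the complement of `P` and `S`, so
they extend to `R₂` and `B`; the prime sought is the kernel of the induced map on `R₂ ⊗ B`. -/
theorem exists_prime_comap_includeRight_eq {R C B R₁ R₂ : Type*} [CommRing R] [CommRing C]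
    [CommRing B] [CommRing R₁] [CommRing R₂] [Algebra R C] [Algebra R B] [Algebra C B]
    [IsScalarTower R C B] [Algebra R R₁] [Algebra R R₂] [Algebra R₁ R₂] [IsScalarTower R R₁ R₂]
    (S : Submonoid C) [IsLocalization S B] (P : Ideal R₁) [P.IsPrime] [IsLocalization.AtPrime R₂ P]
    (P₁ : Ideal (R₁ ⊗[R] C)) [P₁.IsPrime] [P₁.LiesOver P] (x : Ideal B) [x.IsPrime]
    (hx : P₁.comap (Algebra.TensorProduct.includeRight (R := R) (A := R₁)).toRingHom =
      x.comap (algebraMap C B)) :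
    ∃ P₂ : Ideal (R₂ ⊗[R] B), P₂.IsPrime ∧
      P₂.comap (Algebra.TensorProduct.includeRight (R := R) (A := R₂)).toRingHom = x ∧
      P₂.comap (Algebra.TensorProduct.map (Algebra.ofId R₁ R₂)
        (IsScalarTower.toAlgHom R C B)).toRingHom = P₁ := by
  obtain ⟨κ, _, k, hκ⟩ : ∃ (κ : Type _) (_ : Field κ) (k : R₁ ⊗[R] C →+* κ),
      ∀ z, k z = 0 ↔ z ∈ P₁ :=
    ⟨P₁.ResidueField, inferInstance, algebraMap _ _, fun _ ↦ Ideal.algebraMap_residueField_eq_zero⟩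
  let f₁ : R₁ →+* κ := k.comp (algebraMap R₁ _)
  let g₁ : C →+* κ := k.comp (Algebra.TensorProduct.includeRight (R := R) (A := R₁)).toRingHom
  have hP (r : R₁) : f₁ r = 0 ↔ r ∈ P := by
    rw [P₁.over_def P]
    exact hκ _
  have hC (c : C) : g₁ c = 0 ↔ algebraMap C B c ∈ x := by
    rw [← Ideal.mem_comap, ← hx]
    exact hκ _
  let f₂ : R₂ →+* κ := IsLocalization.lift (M := P.primeCompl) (g := f₁)
    fun r ↦ isUnit_iff_ne_zero.mpr fun h ↦ r.2 ((hP _).mp h)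
  let g₂ : B →+* κ := IsLocalization.lift (M := S) (g := g₁) fun s ↦
    isUnit_iff_ne_zero.mpr fun h ↦ ‹x.IsPrime›.ne_top
      (Ideal.eq_top_of_isUnit_mem _ ((hC _).mp h) (IsLocalization.map_units B s))
  have hf₂ (r : R₁) : f₂ (algebraMap R₁ R₂ r) = f₁ r := IsLocalization.lift_eq _ _
  have hg₂ (c : C) : g₂ (algebraMap C B c) = g₁ c := IsLocalization.lift_eq _ _
  let _ : Algebra R κ := (f₂.comp (algebraMap R R₂)).toAlgebra
  let f₃ : R₂ →ₐ[R] κ := ⟨f₂, fun _ ↦ rfl⟩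
  let g₃ : B →ₐ[R] κ := ⟨g₂, fun r ↦ by
    change g₂ (algebraMap R B r) = f₂ (algebraMap R R₂ r)
    rw [IsScalarTower.algebraMap_apply R C B, IsScalarTower.algebraMap_apply R R₁ R₂, hf₂, hg₂]
    exact congr(k $(Algebra.TensorProduct.algebraMap_apply' r)).symm⟩
  let l : R₂ ⊗[R] B →ₐ[R] κ := Algebra.TensorProduct.lift f₃ g₃ fun _ _ ↦ .all _ _
  have hl (z : R₁ ⊗[R] C) : l (Algebra.TensorProduct.map (Algebra.ofId R₁ R₂)
        (IsScalarTower.toAlgHom R C B) z) = k z := by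
    induction z with
    | zero => simp
    | add a b ha hb => simp only [map_add, ha, hb]
    | tmul r c =>
      rw [Algebra.TensorProduct.map_tmul, Algebra.TensorProduct.lift_tmul]
      refine (congr_arg₂ _ (hf₂ r) (hg₂ c)).trans ?_
      refine (map_mul k _ _).symm.trans ?_
      congr 1
      simp
  have hprime : ∀ m : B →+* κ, (RingHom.ker m).IsPrime := fun m ↦ RingHom.ker_isPrime m
  refine ⟨RingHom.ker l.toRingHom, RingHom.ker_isPrime l.toRingHom, ?_, ?_⟩
  · have hx' : RingHom.ker g₂ = x := by
      have := hprime g₂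
      rw [← IsLocalization.map_under S B x, ← IsLocalization.map_under S B (RingHom.ker g₂)]
      congr 1
      ext c
      rw [Ideal.mem_comap, Ideal.mem_comap, RingHom.mem_ker, hg₂, hC]
    rw [← hx']
    ext b
    have : l (1 ⊗ₜ b) = g₂ b := by simp [l, g₃]
    exact (congr_arg (· = 0) this).to_iff
  · ext z
    rw [← hκ, ← hl]
    rfl

/-- Passing from `C` to `B` inverts `S`, which normally destroys finiteness. Once the base is local
at `P`, the elements of `S` are already units in the finite algebra `R₂ ⊗ F₁`, so this algebra
surjects onto `F₂`. -/
theorem finite_of_isLocalizationAway_map {R C B R₁ R₂ F₁ F₂ : Type*} [CommRing R] [CommRing C]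
    [CommRing B] [CommRing R₁] [CommRing R₂] [Algebra R C] [Algebra R B] [Algebra C B]
    [IsScalarTower R C B] [Algebra R R₁] [Algebra R R₂] [Algebra R₁ R₂] [IsScalarTower R R₁ R₂]
    (S : Submonoid C) [IsLocalization S B] (P : Ideal R₁) [P.IsPrime] [IsLocalization.AtPrime R₂ P]
    (P₁ : Ideal (R₁ ⊗[R] C)) (e : R₁ ⊗[R] C)
    (huniq : ∀ Q : Ideal (R₁ ⊗[R] C), Q.IsPrime → Q.LiesOver P → e ∉ Q → Q = P₁)
    (hS : ∀ s ∈ S, (1 : R₁) ⊗ₜ[R] s ∉ P₁) (he : IsIdempotentElem e)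
    [CommRing F₁] [CommRing F₂] [Algebra (R₁ ⊗[R] C) F₁] [Algebra R₁ F₁]
    [IsScalarTower R₁ (R₁ ⊗[R] C) F₁] [IsLocalization.Away e F₁] [Module.Finite R₁ F₁]
    [Algebra (R₂ ⊗[R] B) F₂] [Algebra R₂ F₂] [IsScalarTower R₂ (R₂ ⊗[R] B) F₂]
    [IsLocalization.Away (Algebra.TensorProduct.map (Algebra.ofId R₁ R₂)
        (IsScalarTower.toAlgHom R C B) e) F₂] :
    Module.Finite R₂ F₂ := by
  have : IsLocalRing R₂ := IsLocalization.AtPrime.isLocalRing R₂ P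
  let φ : R₁ ⊗[R] C →ₐ[R₁] R₂ ⊗[R] B :=
    Algebra.TensorProduct.map (Algebra.ofId R₁ R₂) (IsScalarTower.toAlgHom R C B)
  let φ₀ : R₁ ⊗[R] C →+* F₂ := (algebraMap (R₂ ⊗[R] B) F₂).comp φ.toRingHom
  let φ₁ : F₁ →+* F₂ := IsLocalization.Away.lift e (g := φ₀)
    (IsLocalization.Away.algebraMap_isUnit (φ e))
  have hφ₁ (z : R₁ ⊗[R] C) : φ₁ (algebraMap _ F₁ z) = algebraMap _ F₂ (φ z) :=
    IsLocalization.Away.lift_eq _ _ _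
  let _ : Algebra R₁ F₂ := ((algebraMap R₂ F₂).comp (algebraMap R₁ R₂)).toAlgebra
  have : IsScalarTower R₁ R₂ F₂ := .of_algebraMap_eq' rfl
  let φ₂ : F₁ →ₐ[R₁] F₂ := ⟨φ₁, fun r ↦ by
    change φ₁ (algebraMap R₁ F₁ r) = algebraMap R₂ F₂ (algebraMap R₁ R₂ r)
    rw [IsScalarTower.algebraMap_apply R₁ (R₁ ⊗[R] C) F₁, hφ₁,
      IsScalarTower.algebraMap_apply R₂ (R₂ ⊗[R] B) F₂, φ.commutes]
    rfl⟩
  let ψ : R₂ ⊗[R₁] F₁ →ₐ[R₂] F₂ :=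
    Algebra.TensorProduct.lift (Algebra.ofId _ _) φ₂ fun _ _ ↦ .all _ _
  suffices Function.Surjective ψ from .of_surjective ψ.toLinearMap this
  have hψ (z : R₁ ⊗[R] C) : ψ (1 ⊗ₜ algebraMap _ F₁ z) = algebraMap _ F₂ (φ z) := by
    rw [Algebra.TensorProduct.lift_tmul, map_one, one_mul]
    exact hφ₁ z
  let j : R₁ ⊗[R] C →+* R₂ ⊗[R₁] F₁ :=
    (Algebra.TensorProduct.includeRight (R := R₁) (A := R₂) (B := F₁)).toRingHom.comp
      (algebraMap (R₁ ⊗[R] C) F₁)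
  -- A maximal ideal of the finite `R₂`-algebra `R₂ ⊗ F₁` lies over the maximal ideal of `R₂`. It
  -- therefore contracts to a prime over `P` avoiding `e`, that is to `P₁`, which contains no `1 ⊗
  -- s`.
  have hunit (s : C) (hs : s ∈ S) : IsUnit (j (1 ⊗ₜ s)) := by
    by_contra hcon
    obtain ⟨m, hm, hsm⟩ := exists_max_ideal_of_mem_nonunits hcon
    have hmR : m.comap (algebraMap R₂ (R₂ ⊗[R₁] F₁)) = IsLocalRing.maximalIdeal R₂ :=
      IsLocalRing.eq_maximalIdeal (Ideal.isMaximal_comap_of_isIntegral_of_isMaximal m)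
    have hj : m.comap j = P₁ := by
      refine huniq _ inferInstance ⟨?_⟩ ?_
      · rw [Ideal.under, Ideal.comap_comap]
        have : j.comp (algebraMap R₁ (R₁ ⊗[R] C)) =
            (algebraMap R₂ (R₂ ⊗[R₁] F₁)).comp (algebraMap R₁ R₂) := by
          ext r
          simp only [j, RingHom.comp_apply, ← IsScalarTower.algebraMap_apply R₁ (R₁ ⊗[R] C) F₁]
          rw [← IsScalarTower.algebraMap_apply R₁ R₂ (R₂ ⊗[R₁] F₁)]
          exact (Algebra.TensorProduct.includeRight (R := R₁) (A := R₂) (B := F₁)).commutes r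
        rw [this, ← Ideal.comap_comap, hmR]
        exact (IsLocalization.AtPrime.under_maximalIdeal R₂ P).symm
      · intro h
        have : IsUnit (j e) := (IsLocalization.Away.algebraMap_isUnit (S := F₁) e).map
          (Algebra.TensorProduct.includeRight (R := R₁) (A := R₂) (B := F₁))
        exact hm.ne_top (Ideal.eq_top_of_isUnit_mem _ h this)
    exact hS s hs (hj.le hsm)
  have hB (b : B) : algebraMap _ F₂ ((1 : R₂) ⊗ₜ[R] b) ∈ ψ.range := by
    obtain ⟨c, s, rfl⟩ := IsLocalization.exists_mk'_eq S b
    have hs := hunit s s.2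
    refine ⟨j (1 ⊗ₜ c) * ↑(hs.unit⁻¹), ?_⟩
    have h1 : IsUnit (ψ (j (1 ⊗ₜ s))) := hs.map ψ
    rw [← h1.mul_left_inj]
    change ψ _ * _ = _
    rw [← map_mul, mul_assoc, IsUnit.val_inv_mul, mul_one]
    refine (hψ _).trans ?_
    rw [show ψ (j (1 ⊗ₜ s)) = _ from hψ _, ← map_mul]
    congr 1
    simp only [φ, Algebra.TensorProduct.map_tmul, map_one, Algebra.TensorProduct.tmul_mul_tmul,
      one_mul]
    congr 1
    exact (IsLocalization.mk'_spec B c s).symm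
  intro z
  obtain ⟨w, ⟨_, n, rfl⟩, rfl⟩ := IsLocalization.exists_mk'_eq (.powers (φ e)) z
  -- An idempotent becomes 1 once inverted, so denominators can be dropped.
  have : IsLocalization.mk' F₂ w (⟨φ e ^ n, n, rfl⟩ : Submonoid.powers (φ e)) =
      algebraMap _ _ w := by
    rw [IsLocalization.mk'_eq_iff_eq_mul]
    have h1 : algebraMap (R₂ ⊗[R] B) F₂ (φ e) = 1 := by
      refine (IsLocalization.Away.algebraMap_isUnit (S := F₂) (φ e)).mul_left_cancel ?_
      rw [← map_mul, he.map φ, mul_one]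
    simp [map_pow, h1]
  rw [this]
  clear this
  change _ ∈ ψ.range
  induction w with
  | zero => simp
  | add a b ha hb => rw [map_add]; exact add_mem ha hb
  | tmul r b =>
    have : r ⊗ₜ[R] b = r • ((1 : R₂) ⊗ₜ[R] b) := by simp [TensorProduct.smul_tmul']
    rw [this, Algebra.algebraMap_eq_smul_one, smul_assoc, ← Algebra.algebraMap_eq_smul_one]
    exact ψ.range.smul_mem (hB b) r

/-- If `B` is a quasi-finite `R`-algebra essentially of finite type, then after a flat base change
compatible with integral closures, a given prime of `B` lies on a clopen piece of the spectrum
which is finite over the base. -/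
theorem exists_flat_isIdempotentElem_finite {R B : Type u} [CommRing R] [CommRing B] [Algebra R B]
    [Algebra.EssFiniteType R B] [Algebra.QuasiFinite R B] (x : Ideal B) [x.IsPrime] :
    ∃ (R' : Type u) (_ : CommRing R') (_ : Algebra R R'), Module.Flat R R' ∧
      (∀ (G : Type u) [CommRing G] [Algebra R G],
        Function.Bijective (TensorProduct.toIntegralClosure R R' G)) ∧
      ∃ e : R' ⊗[R] B, IsIdempotentElem e ∧ Module.Finite R' (Localization.Away e) ∧
        ∃ P : Ideal (R' ⊗[R] B), P.IsPrime ∧ e ∉ P ∧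
          P.comap (Algebra.TensorProduct.includeRight (R := R) (A := R')).toRingHom = x := by
  let C := Algebra.EssFiniteType.subalgebra R B
  let S := Algebra.EssFiniteType.submonoid R B
  let q : Ideal C := x.comap (algebraMap C B)
  have hq : q.IsPrime := inferInstance
  have hSq : ∀ s ∈ S, s ∉ q := fun s hs hsq ↦ by
    have : IsUnit (algebraMap C B s) := hs
    exact ‹x.IsPrime›.ne_top (Ideal.eq_top_of_isUnit_mem _ hsq this)
  -- The local rings of `B` at `x` and of `C` at `q` coincide, so quasi-finiteness, known for `B`,
  -- holds for the finite type algebra `C` at `q`.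
  have hqf : Algebra.QuasiFiniteAt R q := by
    have : Algebra.QuasiFinite R (Localization.AtPrime x) := inferInstance
    have := IsLocalization.isLocalization_isLocalization_atPrime_isLocalization S
      (Localization.AtPrime x) x
    exact (Algebra.QuasiFinite.iff_of_algEquiv ((IsLocalization.algEquiv q.primeCompl
      (Localization.AtPrime x) (Localization.AtPrime q)).restrictScalars R)).mp ‹_›
  let p : Ideal R := q.under R
  obtain ⟨R₁, _, _, _, P, _, _, e₁, he₁, P₁, _, _, hP₁q, heP₁, -, hfin, huniq⟩ :=
    Algebra.exists_etale_isIdempotentElem_forall_liesOver_eq p q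
  let R₂ := Localization.AtPrime P
  let φ : R₁ ⊗[R] C →ₐ[R₁] R₂ ⊗[R] B :=
    Algebra.TensorProduct.map (Algebra.ofId R₁ R₂) (IsScalarTower.toAlgHom R C B)
  let e := φ e₁
  have he : IsIdempotentElem e := he₁.map φ
  -- Integral closure commutes with smooth base change and with localization, hence with the
  -- composite `R → R₁ → R₂`.
  refine ⟨R₂, inferInstance, inferInstance, .trans R R₁ R₂, fun G _ _ ↦
    TensorProduct.toIntegralClosure_bijective_of_tower (S := R₁)
      TensorProduct.toIntegralClosure_bijective_of_smooth
      (TensorProduct.toIntegralClosure_bijective_of_isLocalization P.primeCompl), e, he, ?_, ?_⟩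
  · exact finite_of_isLocalizationAway_map (F₁ := Localization.Away e₁) (R₂ := R₂) (B := B) S P P₁ e₁ huniq
      (fun s hs h ↦ hSq s hs (hP₁q.le h)) he₁
  · obtain ⟨P₂, h₁, h₂, h₃⟩ := exists_prime_comap_includeRight_eq (R₂ := R₂) S P P₁ x hP₁q
    exact ⟨P₂, h₁, fun h ↦ heP₁ (h₃.le h), h₂⟩

/-! ### Flat base change of sections and the clopen finite piece. -/

/-- The spectrum of an algebra over the sections on an affine open, as a scheme over the whole. -/
noncomputable def specToScheme {Y : Scheme.{u}} {V : Y.Opens} (hV : IsAffineOpen V) (R' : Type u)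
    [CommRing R'] [Algebra Γ(Y, V) R'] : Spec (.of R') ⟶ Y :=
  Spec.map (CommRingCat.ofHom (algebraMap Γ(Y, V) R')) ≫ hV.fromSpec

theorem specToScheme_preimage {Y : Scheme.{u}} {V : Y.Opens} (hV : IsAffineOpen V) (R' : Type u)
    [CommRing R'] [Algebra Γ(Y, V) R'] : specToScheme hV R' ⁻¹ᵁ V = ⊤ := by
  simp [specToScheme]

theorem specToScheme_appLE {Y : Scheme.{u}} {V : Y.Opens} (hV : IsAffineOpen V) (R' : Type u)
    [CommRing R'] [Algebra Γ(Y, V) R'] :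
    (specToScheme hV R').appLE V ⊤ (specToScheme_preimage hV R').ge =
      CommRingCat.ofHom (algebraMap Γ(Y, V) R') ≫ (Scheme.ΓSpecIso (.of R')).inv := by
  have h1 : hV.fromSpec.appLE V ⊤ (by simp) = (Scheme.ΓSpecIso Γ(Y, V)).inv := by
    simp [Scheme.Hom.appLE, IsAffineOpen.fromSpec_app_self, ← Functor.map_comp]
  have h2 : (Spec.map (CommRingCat.ofHom (algebraMap Γ(Y, V) R'))).appLE ⊤ ⊤ le_top =
      (Spec.map (CommRingCat.ofHom (algebraMap Γ(Y, V) R'))).appTop :=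
    (Scheme.Hom.app_eq_appLE ..).symm
  rw [Scheme.ΓSpecIso_inv_naturality, ← h2]
  exact (Scheme.Hom.appLE_comp_appLE ..).symm.trans (congr_arg (· ≫ _) h1)

/-- Flat base change for global sections: a finite affine cover gives injectivity, while
surjectivity also needs quasi-compact overlaps. -/
theorem exists_sections_baseChange {X Y : Scheme.{u}} (f : X ⟶ Y) {V : Y.Opens}
    (hV : IsAffineOpen V) (R' : Type u) [CommRing R'] [Algebra Γ(Y, V) R'] [Module.Flat Γ(Y, V) R']
    {Q : Scheme.{u}} {p : Q ⟶ X} {π : Q ⟶ Spec (.of R')}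
    (H : IsPullback p π f (specToScheme hV R')) (hp : ⊤ ≤ p ⁻¹ᵁ f ⁻¹ᵁ V) [QuasiCompact f] :
    letI := (f.app V).hom.toAlgebra
    ∃ Ψ : R' ⊗[Γ(Y, V)] Γ(X, f ⁻¹ᵁ V) →+* Γ(Q, ⊤),
      (∀ r : R', Ψ (r ⊗ₜ 1) = π.appTop ((Scheme.ΓSpecIso (.of R')).inv r)) ∧
      (∀ g : Γ(X, f ⁻¹ᵁ V), Ψ (1 ⊗ₜ g) = p.appLE (f ⁻¹ᵁ V) ⊤ hp g) ∧
      Function.Injective Ψ ∧ (QuasiSeparated f → Function.Surjective Ψ) := by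
  let _ := (f.app V).hom.toAlgebra
  have : Flat (specToScheme hV R') := by
    have : Flat (Spec.map (CommRingCat.ofHom (algebraMap Γ(Y, V) R'))) := by
      rw [Flat.SpecMap_iff]
      exact RingHom.flat_algebraMap_iff.mpr ‹_›
    unfold specToScheme
    infer_instance
  have hUY : (⊤ : Q.Opens) = p ⁻¹ᵁ f ⁻¹ᵁ V ⊓ π ⁻¹ᵁ ⊤ := by
    simpa using le_antisymm hp le_top
  have sq := CommRingCat.isPushout_tensorProduct Γ(Y, V) R' Γ(X, f ⁻¹ᵁ V)
  have sq' : IsPushout (f.appLE V (f ⁻¹ᵁ V) le_rfl)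
      ((specToScheme hV R').appLE V ⊤ (specToScheme_preimage hV R').ge)
      (CommRingCat.ofHom (S := R' ⊗[Γ(Y, V)] Γ(X, f ⁻¹ᵁ V))
        Algebra.TensorProduct.includeRight.toRingHom)
      ((Scheme.ΓSpecIso (.of R')).hom ≫ CommRingCat.ofHom (S := R' ⊗[Γ(Y, V)] Γ(X, f ⁻¹ᵁ V))
        Algebra.TensorProduct.includeLeftRingHom) := by
    refine sq.flip.of_iso (.refl _) (.refl _) (Scheme.ΓSpecIso (.of R')).symm (.refl _)
      ?_ ?_ ?_ ?_
    · simp [RingHom.algebraMap_toAlgebra, Scheme.Hom.app_eq_appLE]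
    · simp [specToScheme_appLE]
    · simp
    · simp
  let ψ := pushoutSection H (specToScheme_preimage hV R').ge le_rfl hUY
  let Ψ := sq'.isoPushout.hom ≫ ψ
  have h1 : CommRingCat.ofHom (S := R' ⊗[Γ(Y, V)] Γ(X, f ⁻¹ᵁ V))
        Algebra.TensorProduct.includeRight.toRingHom ≫ Ψ = p.appLE (f ⁻¹ᵁ V) ⊤ hp := by
    simpa [Ψ] using pushout.inl_desc _ _ _
  have h2 : CommRingCat.ofHom (S := R' ⊗[Γ(Y, V)] Γ(X, f ⁻¹ᵁ V))
        Algebra.TensorProduct.includeLeftRingHom ≫ Ψ =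
      (Scheme.ΓSpecIso (.of R')).inv ≫ π.appTop := by
    rw [Iso.eq_inv_comp, ← Category.assoc]
    simp only [Ψ, IsPushout.inr_isoPushout_hom_assoc, ψ, pushout.inr_desc]
    exact (Scheme.Hom.app_eq_appLE ..).symm
  have hc : IsCompact (X := X) (f ⁻¹ᵁ V : X.Opens) := f.isCompact_preimage hV.isCompact
  have := mono_pushoutSection_of_isCompact_of_flat_right H (specToScheme_preimage hV R').ge
    le_rfl hUY hV (isAffineOpen_top _) hc
  refine ⟨Ψ.hom, fun r ↦ congr($h2 r), fun g ↦ congr($h1 g), ?_, fun _ ↦ ?_⟩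
  · have : Mono Ψ := mono_comp _ _
    exact (ConcreteCategory.mono_iff_injective_of_preservesPullback Ψ).mp this
  · have := isIso_pushoutSection_of_isQuasiSeparated_of_flat_right H
      (specToScheme_preimage hV R').ge le_rfl hUY hV (isAffineOpen_top _) hc
      (f.isQuasiSeparated_preimage hV.isQuasiSeparated)
    have : IsIso Ψ := IsIso.comp_isIso
    exact ((ConcreteCategory.isIso_iff_bijective Ψ).mp this).2

theorem eq_zero_of_map_eq_zero {X : Scheme.{u}} {W W' : X.Opens} (h : W ⊔ W' = ⊤) (s : Γ(X, ⊤))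
    (h₁ : X.presheaf.map (homOfLE (le_top : W ≤ ⊤)).op s = 0)
    (h₂ : X.presheaf.map (homOfLE (le_top : W' ≤ ⊤)).op s = 0) : s = 0 :=
  X.sheaf.eq_of_locally_eq₂ (homOfLE (le_top : W ≤ ⊤)) (homOfLE (le_top : W' ≤ ⊤)) h.ge s 0
    (h₁.trans (map_zero _).symm) (h₂.trans (map_zero _).symm)

theorem exists_map_eq_one_map_eq_zero {X : Scheme.{u}} {W W' : X.Opens} (h : IsCompl W W') :
    ∃ ε : Γ(X, ⊤), X.presheaf.map (homOfLE (le_top : W ≤ ⊤)).op ε = 1 ∧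
      X.presheaf.map (homOfLE (le_top : W' ≤ ⊤)).op ε = 0 := by
  let F : Bool → X.Opens := fun b ↦ if b then W else W'
  have hF : ⊤ ≤ iSup F := h.sup_eq_top.ge.trans
    (sup_le (le_iSup F true) (le_iSup F false))
  obtain ⟨ε, hε, -⟩ := X.sheaf.existsUnique_gluing' F ⊤ (fun i ↦ homOfLE le_top) hF
    (fun i ↦ if i then 1 else 0) (by
      intro i j
      cases i <;> cases j
      · rfl
      · have : Subsingleton Γ(X, F false ⊓ F true) := by
          have : F false ⊓ F true = ⊥ := h.symm.inf_eq_bot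
          rw [this]; infer_instance
        exact this.elim _ _
      · have : Subsingleton Γ(X, F true ⊓ F false) := by
          have : F true ⊓ F false = ⊥ := h.inf_eq_bot
          rw [this]; infer_instance
        exact this.elim _ _
      · rfl)
  exact ⟨ε, hε true, hε false⟩

/-- The spectrum of `Localization.Away e` is open in the base change of `X`, and it is also closed
because it is finite over a base over which that scheme is separated. -/
theorem exists_isCompl_isFinite {X Y : Scheme.{u}} (f : X ⟶ Y) [IsSeparated f] {V : Y.Opens}
    (hV : IsAffineOpen V) {U : X.Opens} (hU : IsAffineOpen U) (hUV : U ≤ f ⁻¹ᵁ V) (x : U)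
    (R' : Type u) [CommRing R'] [Algebra Γ(Y, V) R'] [Algebra Γ(Y, V) Γ(X, U)]
    (halg : algebraMap Γ(Y, V) Γ(X, U) = (f.appLE V U hUV).hom)
    (e : R' ⊗[Γ(Y, V)] Γ(X, U)) [Module.Finite R' (Localization.Away e)]
    (P : Ideal (R' ⊗[Γ(Y, V)] Γ(X, U))) [P.IsPrime] (heP : e ∉ P)
    (hP : P.comap (Algebra.TensorProduct.includeRight (R := Γ(Y, V)) (A := R')).toRingHom =
      (hU.primeIdealOf x).asIdeal) :
    ∃ W W' : (pullback f (specToScheme hV R')).Opens, IsCompl W W' ∧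
      W ≤ pullback.fst f (specToScheme hV R') ⁻¹ᵁ U ∧
      (∃ v ∈ W, pullback.fst f (specToScheme hV R') v = x.1) ∧
      IsFinite (W.ι ≫ pullback.snd f (specToScheme hV R')) := by
  have hfin₀ : (algebraMap R' (Localization.Away e)).Finite := RingHom.finite_algebraMap.mpr ‹_›
  let φ : Γ(Y, V) ⟶ .of R' := CommRingCat.ofHom <| algebraMap Γ(Y, V) R'
  have hφ : f.appLE V U hUV = CommRingCat.ofHom (algebraMap _ _) := by rw [halg]; rfl
  let e₁ : Spec (.of (R' ⊗[Γ(Y, V)] Γ(X, U))) ≅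
      pullback (Spec.map (CommRingCat.ofHom (algebraMap Γ(Y, V) Γ(X, U)))) (Spec.map φ) :=
    (pullbackSpecIso _ _ _).symm ≪≫ pullbackSymmetry _ _
  have he₁ : e₁.hom ≫ pullback.fst _ _ =
      Spec.map (CommRingCat.ofHom Algebra.TensorProduct.includeRight.toRingHom) := by
    dsimp [e₁]
    rw [Category.assoc, pullbackSymmetry_hom_comp_fst]
    exact pullbackSpecIso_inv_snd ..
  let g : Spec (.of (R' ⊗[Γ(Y, V)] Γ(X, U))) ⟶ pullback f (specToScheme hV R') :=
    e₁.hom ≫ pullback.map _ _ _ _ hU.fromSpec (𝟙 _) hV.fromSpec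
      (by rw [← hφ, IsAffineOpen.SpecMap_appLE_fromSpec]) (by simp [specToScheme, φ])
  have hg : g ≫ pullback.fst f (specToScheme hV R') =
      Spec.map (CommRingCat.ofHom Algebra.TensorProduct.includeRight.toRingHom) ≫ hU.fromSpec := by
    refine (Category.assoc _ _ _).trans ?_
    refine (congr(e₁.hom ≫ $(pullback.lift_fst _ _ _))).trans ?_
    rw [← Category.assoc, he₁]
  let ι : Spec (.of (Localization.Away e)) ⟶ pullback f (specToScheme hV R') :=
    Spec.map (CommRingCat.ofHom <| algebraMap _ _) ≫ g
  have hι : IsFinite (ι ≫ pullback.snd f (specToScheme hV R')) := by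
    have H : (pullbackSpecIso Γ(Y, V) R' Γ(X, U)).inv ≫ pullback.fst _ _ = _ :=
      pullbackSpecIso_inv_fst ..
    simp only [ι, g, e₁, φ, Category.assoc, pullback.lift_snd, pullback.map, Iso.trans_hom, Iso.symm_hom,
      Category.comp_id, pullbackSymmetry_hom_comp_snd, H, ← Spec.map_comp, IsFinite.SpecMap_iff]
    exact hfin₀
  -- Cancellation for finite morphisms: this is where separatedness of `f` enters.
  have hfin : IsFinite ι := .of_comp ι (pullback.snd f (specToScheme hV R'))
  let W := ι.opensRange
  have hW : IsFinite (W.ι ≫ pullback.snd f (specToScheme hV R')) := by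
    rw [← Scheme.Hom.isoOpensRange_inv_comp, Category.assoc]
    infer_instance
  let W' : (pullback f (specToScheme hV R')).Opens :=
    ⟨Wᶜ, by simpa [W] using ι.isClosedMap.isClosed_range⟩
  refine ⟨W, W', ?_, ?_, ?_, hW⟩
  · simp [isCompl_iff, disjoint_iff, codisjoint_iff, W', SetLike.ext'_iff]
  · rintro _ ⟨z, rfl⟩
    change pullback.fst f (specToScheme hV R') (ι z) ∈ U
    rw [← Scheme.Hom.comp_apply]
    simp only [ι, Category.assoc, hg]
    rw [Scheme.Hom.comp_apply, Scheme.Hom.comp_apply]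
    have := hU.range_fromSpec
    exact this.le ⟨_, rfl⟩
  · refine ⟨g ⟨P, ‹_›⟩, ?_, ?_⟩
    · change _ ∈ Set.range ι
      simp only [ι, Scheme.Hom.comp_base, TopCat.coe_comp, Set.range_comp]
      refine ⟨_, ?_, rfl⟩
      exact (PrimeSpectrum.localization_away_comap_range (Localization.Away e) e).ge heP
    · refine (Scheme.Hom.comp_apply _ _ _).symm.trans ?_
      rw [hg]
      refine (Scheme.Hom.comp_apply _ _ _).trans ?_
      refine .trans ?_ (hU.fromSpec_primeIdealOf x)
      exact congr(hU.fromSpec $(PrimeSpectrum.ext hP))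

theorem map_eq_zero_of_ι_appTop_eq_zero {X : Scheme.{u}} (W : X.Opens) (s : Γ(X, ⊤))
    (h : W.ι.appTop s = 0) : X.presheaf.map (homOfLE (le_top : W ≤ ⊤)).op s = 0 := by
  have h1 : X.presheaf.map (homOfLE (le_top : W ≤ ⊤)).op = W.ι.appTop ≫ W.topIso.hom := by
    rw [Scheme.Opens.ι_appTop, Scheme.Opens.topIso_hom]
    exact X.presheaf.map_comp _ _
  rw [h1, CommRingCat.comp_apply, h, map_zero]

/-- A section supported on a clopen piece which is integral over an affine base is integral. -/
theorem isIntegralElem_mul_of_isCompl {Q T : Scheme.{u}} [IsAffine T] (π : Q ⟶ T) {W W' : Q.Opens}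
    (h : IsCompl W W') [IsIntegralHom (W.ι ≫ π)] (ε : Γ(Q, ⊤))
    (h₁ : Q.presheaf.map (homOfLE (le_top : W ≤ ⊤)).op ε = 1)
    (h₂ : Q.presheaf.map (homOfLE (le_top : W' ≤ ⊤)).op ε = 0) (t : Γ(Q, ⊤)) :
    π.appTop.hom.IsIntegralElem (ε * t) := by
  obtain ⟨g, hg, hgt⟩ := IsIntegralHom.isIntegral_app (W.ι ≫ π) ⊤ (isAffineOpen_top T)
    (W.ι.appTop t)
  have hs : W.ι.appTop (g.eval₂ π.appTop.hom t) = 0 := by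
    refine Eq.trans ?_ hgt
    exact Polynomial.hom_eval₂ g π.appTop.hom W.ι.appTop.hom t
  have hs' := map_eq_zero_of_ι_appTop_eq_zero W _ hs
  -- The factor `g` vanishes at `ε t` on `W`, where `ε = 1`; the factor `X` does so on `W'`, where
  -- `ε = 0`.
  refine ⟨Polynomial.X * g, Polynomial.monic_X.mul hg, ?_⟩
  rw [Polynomial.eval₂_mul, Polynomial.eval₂_X]
  refine eq_zero_of_map_eq_zero h.sup_eq_top _ ?_ ?_
  · have : Q.presheaf.map (homOfLE (le_top : W ≤ ⊤)).op (g.eval₂ π.appTop.hom (ε * t)) =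
        Q.presheaf.map (homOfLE (le_top : W ≤ ⊤)).op (g.eval₂ π.appTop.hom t) := by
      refine (Polynomial.hom_eval₂ g π.appTop.hom (Q.presheaf.map _).hom (ε * t)).trans ?_
      refine .trans ?_ (Polynomial.hom_eval₂ g π.appTop.hom (Q.presheaf.map _).hom t).symm
      congr 1
      rw [map_mul]
      erw [h₁]
      rw [one_mul]
    rw [map_mul, this, hs', mul_zero]
  · rw [map_mul, map_mul, h₂, zero_mul, zero_mul]

/-- Each `ε t` is integral over `R'`. Since sections and integral closure both commute with the base
change, it comes from `R' ⊗ A`, with `A` the integral closure before base change. -/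
theorem exists_baseChange_section {X Y : Scheme.{u}} (f : X ⟶ Y) [IsSeparated f] [QuasiCompact f]
    {V : Y.Opens} (hV : IsAffineOpen V) {U : X.Opens} (hU : IsAffineOpen U) (hUV : U ≤ f ⁻¹ᵁ V)
    (hft : (f.appLE V U hUV).hom.EssFiniteType) (hqf : (f.appLE V U hUV).hom.QuasiFinite)
    (x : X) (hx : x ∈ U) :
    letI := (f.app V).hom.toAlgebra
    ∃ (R' : Type u) (_ : CommRing R') (_ : Algebra Γ(Y, V) R') (_ : Module.Flat Γ(Y, V) R')
      (Ψ : R' ⊗[Γ(Y, V)] Γ(X, f ⁻¹ᵁ V) →+* Γ(pullback f (specToScheme hV R'), ⊤)),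
      Function.Injective Ψ ∧
      (∀ r : R', Ψ (r ⊗ₜ 1) =
        (pullback.snd f (specToScheme hV R')).appTop ((Scheme.ΓSpecIso (.of R')).inv r)) ∧
      ∃ (hp : ⊤ ≤ pullback.fst f (specToScheme hV R') ⁻¹ᵁ f ⁻¹ᵁ V),
      (∀ g : Γ(X, f ⁻¹ᵁ V), Ψ (1 ⊗ₜ g) =
        (pullback.fst f (specToScheme hV R')).appLE (f ⁻¹ᵁ V) ⊤ hp g) ∧
      ∃ (W W' : (pullback f (specToScheme hV R')).Opens), IsCompl W W' ∧
        W ≤ pullback.fst f (specToScheme hV R') ⁻¹ᵁ U ∧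
        (∃ v ∈ W, pullback.fst f (specToScheme hV R') v = x) ∧
      ∃ (ε : Γ(pullback f (specToScheme hV R'), ⊤)),
        (pullback f (specToScheme hV R')).presheaf.map (homOfLE (le_top : W ≤ ⊤)).op ε = 1 ∧
        (pullback f (specToScheme hV R')).presheaf.map (homOfLE (le_top : W' ≤ ⊤)).op ε = 0 ∧
        ∀ t, ∃ z : R' ⊗[Γ(Y, V)] integralClosure Γ(Y, V) Γ(X, f ⁻¹ᵁ V),
          Ψ (Algebra.TensorProduct.map (.id R' R') (integralClosure _ _).val z) = ε * t := by
  let _ := (f.app V).hom.toAlgebra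
  let _ := (f.appLE V U hUV).hom.toAlgebra
  have : Algebra.EssFiniteType Γ(Y, V) Γ(X, U) := hft
  have : Algebra.QuasiFinite Γ(Y, V) Γ(X, U) := hqf
  obtain ⟨R', _, _, _, hic, e, he, hfin, P, hP, heP, hPx⟩ :=
    exists_flat_isIdempotentElem_finite (R := Γ(Y, V)) (B := Γ(X, U))
      (hU.primeIdealOf ⟨x, hx⟩).asIdeal
  obtain ⟨W, W', hWW', hWU, hv, hWfin⟩ :=
    exists_isCompl_isFinite f hV hU hUV ⟨x, hx⟩ R' rfl e P heP hPx
  obtain ⟨ε, hε₁, hε₂⟩ := exists_map_eq_one_map_eq_zero hWW'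
  have hp : ⊤ ≤ pullback.fst f (specToScheme hV R') ⁻¹ᵁ f ⁻¹ᵁ V := by
    rw [← Scheme.Hom.comp_preimage, pullback.condition, Scheme.Hom.comp_preimage,
      specToScheme_preimage]
    rfl
  obtain ⟨Ψ, hΨ₁, hΨ₂, hinj, hsurj⟩ := exists_sections_baseChange f hV R'
    (IsPullback.of_hasPullback f (specToScheme hV R')) hp
  refine ⟨R', inferInstance, inferInstance, inferInstance, Ψ, hinj, hΨ₁, hp, hΨ₂, W, W', hWW', hWU,
    hv, ε, hε₁, hε₂, fun t ↦ ?_⟩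
  obtain ⟨a, ha⟩ := hsurj inferInstance (ε * t)
  have hint : IsIntegral R' a := by
    obtain ⟨g, hg, hgt⟩ := isIntegralElem_mul_of_isCompl (pullback.snd f (specToScheme hV R'))
      hWW' ε hε₁ hε₂ t
    refine ⟨g.map (Scheme.ΓSpecIso (.of R')).hom.hom, hg.map _, hinj ?_⟩
    rw [map_zero, ← hgt, Polynomial.eval₂_map, Polynomial.hom_eval₂, ha]
    congr 1
    ext r
    refine (hΨ₁ _).trans ?_
    simp
  obtain ⟨z, hz⟩ := (hic Γ(X, f ⁻¹ᵁ V)).2 ⟨a, hint⟩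
  exact ⟨z, by rw [← ha]; exact congr(Ψ ($hz).1)⟩

/-! ### Descent from the base change to integral sections on `X`. -/

theorem exists_mem_range_lTensor_ker {R M N R' : Type*} [CommRing R] [AddCommGroup M] [Module R M]
    [AddCommGroup N] [Module R N] [AddCommGroup R'] [Module R R'] [Module.Flat R R'] (u : M →ₗ[R] N)
    (z : R' ⊗[R] M) (hz : u.lTensor R' z = 0) :
    ∃ y, (LinearMap.ker u).subtype.lTensor R' y = z :=
  (Module.Flat.lTensor_exact R' (LinearMap.exact_subtype_ker_map u) z).mp hz

theorem appLE_comp_appTop {X Y Z : Scheme.{u}} (g : X ⟶ Y) (h : Y ⟶ Z) (V : Z.Opens)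
    (e : ⊤ ≤ h ⁻¹ᵁ V) (e' : ⊤ ≤ (g ≫ h) ⁻¹ᵁ V) :
    h.appLE V ⊤ e ≫ g.appTop = (g ≫ h).appLE V ⊤ e' := by
  rw [Scheme.Hom.appTop, Scheme.Hom.app_eq_appLE]
  exact Scheme.Hom.appLE_comp_appLE ..

theorem mem_basicOpen_of_map_eq_one {Q : Scheme.{u}} {W : Q.Opens} (ε : Γ(Q, ⊤))
    (h : Q.presheaf.map (homOfLE (le_top : W ≤ ⊤)).op ε = 1) : W ≤ Q.basicOpen ε := by
  have := Q.basicOpen_res ε (homOfLE (le_top : W ≤ ⊤)).op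
  rw [h, Scheme.basicOpen_of_isUnit _ isUnit_one] at this
  exact this.le.trans inf_le_right

/-- If a section of the base change which does not vanish at a point over `x` is a combination of
elements of a submodule, then an element of the submodule does not vanish at `x`. -/
theorem exists_mem_ker_mem_basicOpen {X Q : Scheme.{u}} {V : X.Opens} {R R' N : Type u}
    [CommRing R] [CommRing R'] [Algebra R R'] [Module.Flat R R'] [Algebra R Γ(X, V)]
    (A : Subalgebra R Γ(X, V)) [AddCommGroup N] [Module R N] (u : A →ₗ[R] N)
    (p : Q ⟶ X) (hp : ⊤ ≤ p ⁻¹ᵁ V) (Ψ : R' ⊗[R] Γ(X, V) →+* Γ(Q, ⊤))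
    (hΨ : ∀ g : Γ(X, V), Ψ (1 ⊗ₜ g) = p.appLE V ⊤ hp g) (v : Q) (z : R' ⊗[R] A)
    (hv : v ∈ Q.basicOpen (Ψ (Algebra.TensorProduct.map (.id R' R') A.val z)))
    (hz : u.lTensor R' z = 0) : ∃ s ∈ LinearMap.ker u, p v ∈ X.basicOpen s.1 := by
  by_contra! hcon
  obtain ⟨y, rfl⟩ := exists_mem_range_lTensor_ker u z hz
  let I : Ideal Γ(Q, ⊤) := (IsLocalRing.maximalIdeal _).comap (Q.presheaf.germ ⊤ v trivial).hom
  have hI (t : Γ(Q, ⊤)) : t ∈ I ↔ v ∉ Q.basicOpen t := by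
    rw [Q.mem_basicOpen t v trivial]
    rfl
  refine (hI _).mp ?_ hv
  clear hv hz
  induction y with
  | zero => simp
  | add a b ha hb =>
    simp only [map_add]
    exact add_mem ha hb
  | tmul r s =>
    have : Ψ (Algebra.TensorProduct.map (.id R' R') A.val
        ((LinearMap.ker u).subtype.lTensor R' (r ⊗ₜ s))) = Ψ (r ⊗ₜ 1) * Ψ (1 ⊗ₜ s.1.1) := by
      rw [← map_mul]
      simp
    rw [this]
    refine I.mul_mem_left _ ((hI _).mpr fun h ↦ hcon s.1 s.2 ?_)
    rw [hΨ, Scheme.basicOpen_appLE] at h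
    exact h.2

/-- The wanted `s` form the kernel of `A → G / A`, `s ↦ s γ`, where `G` is the ring of sections over
`f⁻¹ V`. After base change `ε` lies in this kernel, because `ε γ` also comes from `R' ⊗ A`. -/
theorem exists_isIntegralElem_mul {X Y : Scheme.{u}} (f : X ⟶ Y) [IsSeparated f] [QuasiCompact f]
    {V : Y.Opens} (hV : IsAffineOpen V) {U : X.Opens} (hU : IsAffineOpen U) (hUV : U ≤ f ⁻¹ᵁ V)
    (hft : (f.appLE V U hUV).hom.EssFiniteType) (hqf : (f.appLE V U hUV).hom.QuasiFinite)
    (x : X) (hx : x ∈ U) (γ : Γ(X, f ⁻¹ᵁ V)) :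
    ∃ s : Γ(X, f ⁻¹ᵁ V), (f.app V).hom.IsIntegralElem s ∧ (f.app V).hom.IsIntegralElem (s * γ) ∧
      x ∈ X.basicOpen s := by
  let _ := (f.app V).hom.toAlgebra
  obtain ⟨R', _, _, _, Ψ, hinj, hΨ₁, hp, hΨ₂, W, W', hWW', hWU, ⟨v, hvW, hvx⟩, ε, hε₁, hε₂, hε⟩ :=
    exists_baseChange_section f hV hU hUV hft hqf x hx
  let A := integralClosure Γ(Y, V) Γ(X, f ⁻¹ᵁ V)
  let N := Γ(X, f ⁻¹ᵁ V) ⧸ Subalgebra.toSubmodule A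
  let mk : Γ(X, f ⁻¹ᵁ V) →ₗ[Γ(Y, V)] N := (Subalgebra.toSubmodule A).mkQ
  let u : A →ₗ[Γ(Y, V)] N := mk ∘ₗ (LinearMap.mulRight Γ(Y, V) γ) ∘ₗ A.val.toLinearMap
  obtain ⟨z, hz⟩ := hε 1
  rw [mul_one] at hz
  obtain ⟨z', hz'⟩ := hε (Ψ (1 ⊗ₜ γ))
  have hzz : Algebra.TensorProduct.map (.id R' R') A.val z * (1 ⊗ₜ γ) =
      Algebra.TensorProduct.map (.id R' R') A.val z' := by
    apply hinj
    rw [map_mul, hz, hz']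
  have hmk (w : R' ⊗[Γ(Y, V)] A) :
      mk.lTensor R' (Algebra.TensorProduct.map (.id R' R') A.val w) = 0 := by
    induction w with
    | zero => simp
    | add a b ha hb => simp only [map_add, ha, hb, add_zero]
    | tmul r a =>
      simp only [Algebra.TensorProduct.map_tmul, LinearMap.lTensor_tmul]
      have : mk (A.val a) = 0 := (Submodule.Quotient.mk_eq_zero _).mpr a.2
      rw [this, tmul_zero]
  have hu (w : R' ⊗[Γ(Y, V)] A) : u.lTensor R' w =
      mk.lTensor R' (Algebra.TensorProduct.map (.id R' R') A.val w * (1 ⊗ₜ γ)) := by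
    induction w with
    | zero => simp
    | add a b ha hb => simp only [map_add, ha, hb, add_mul]
    | tmul r a => simp [u]
  obtain ⟨s, hs, hxs⟩ := exists_mem_ker_mem_basicOpen A u _ hp Ψ hΨ₂ v z
    (by rw [hz]; exact mem_basicOpen_of_map_eq_one ε hε₁ hvW) (by rw [hu, hzz, hmk])
  exact ⟨s.1, s.2, (Submodule.Quotient.mk_eq_zero _).mp hs, hvx ▸ hxs⟩

/-- Here the linear map is restriction of integral sections to the reduced complement of `U`. Its
base change kills `ε`, since `W` lies over `U`. -/
theorem exists_isIntegralElem_basicOpen_le {X Y : Scheme.{u}} (f : X ⟶ Y) [IsSeparated f] [QuasiCompact f]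
    {V : Y.Opens} (hV : IsAffineOpen V) {U : X.Opens} (hU : IsAffineOpen U) (hUV : U ≤ f ⁻¹ᵁ V)
    (hft : (f.appLE V U hUV).hom.EssFiniteType) (hqf : (f.appLE V U hUV).hom.QuasiFinite)
    (x : X) (hx : x ∈ U) :
    ∃ s : Γ(X, f ⁻¹ᵁ V), (f.app V).hom.IsIntegralElem s ∧ x ∈ X.basicOpen s ∧
      X.basicOpen s ≤ U := by
  let _ := (f.app V).hom.toAlgebra
  obtain ⟨R', _, _, _, Ψ, hinj, hΨ₁, hp, hΨ₂, W, W', hWW', hWU, ⟨v, hvW, hvx⟩, ε, hε₁, hε₂, hε⟩ :=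
    exists_baseChange_section f hV hU hUV hft hqf x hx
  let A := integralClosure Γ(Y, V) Γ(X, f ⁻¹ᵁ V)
  let I := Scheme.IdealSheafData.vanishingIdeal (X := X) ⟨(U : Set X)ᶜ, U.2.isClosed_compl⟩
  let ι := I.subschemeι
  have hι : Set.range ι = (U : Set X)ᶜ := by
    simp [ι, I]
  let m := ι ≫ f
  let _ := (m.app V).hom.toAlgebra
  let t := specToScheme hV R'
  have hpm : ⊤ ≤ pullback.fst m t ⁻¹ᵁ m ⁻¹ᵁ V := by
    rw [← Scheme.Hom.comp_preimage, pullback.condition, Scheme.Hom.comp_preimage,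
      specToScheme_preimage]
    rfl
  obtain ⟨Φ, hΦ₁, hΦ₂, hΦ, -⟩ := exists_sections_baseChange m hV R'
    (IsPullback.of_hasPullback m t) hpm
  let w : pullback m t ⟶ pullback f t :=
    pullback.lift (pullback.fst m t ≫ ι) (pullback.snd m t) (by simp [← pullback.condition, m])
  have hw₁ : w ≫ pullback.fst f t = pullback.fst m t ≫ ι := pullback.lift_fst _ _ _
  have hw₂ : w ≫ pullback.snd f t = pullback.snd m t := pullback.lift_snd _ _ _
  let σ : Γ(X, f ⁻¹ᵁ V) →+* Γ(I.subscheme, m ⁻¹ᵁ V) := (ι.app (f ⁻¹ᵁ V)).hom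
  have hσ (r : Γ(Y, V)) : σ (algebraMap _ _ r) = algebraMap _ _ r := rfl
  let ρ : Γ(X, f ⁻¹ᵁ V) →ₐ[Γ(Y, V)] Γ(I.subscheme, m ⁻¹ᵁ V) := ⟨σ, hσ⟩
  have hw₃ (y) : w.appTop ((pullback.snd f t).appTop y) = (pullback.snd m t).appTop y := by
    rw [← hw₂, Scheme.Hom.comp_appTop, CommRingCat.comp_apply]
  have hw₄ (g : Γ(X, f ⁻¹ᵁ V)) : w.appTop ((pullback.fst f t).appLE (f ⁻¹ᵁ V) ⊤ hp g) =
      (pullback.fst m t).appLE (m ⁻¹ᵁ V) ⊤ hpm (σ g) := by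
    have h1 : (pullback.fst f t).appLE (f ⁻¹ᵁ V) ⊤ hp ≫ w.appTop =
        (w ≫ pullback.fst f t).appLE (f ⁻¹ᵁ V) ⊤ (fun y _ ↦ hp (trivial : w y ∈ ⊤)) :=
      appLE_comp_appTop _ _ _ _ _
    have h2 : ι.app (f ⁻¹ᵁ V) ≫ (pullback.fst m t).appLE (m ⁻¹ᵁ V) ⊤ hpm =
        (pullback.fst m t ≫ ι).appLE (f ⁻¹ᵁ V) ⊤ hpm :=
      (Scheme.Hom.comp_appLE _ _ _ _ _).symm
    refine (congr($h1 g)).trans ?_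
    refine .trans ?_ (congr($h2 g)).symm
    simp only [hw₁]
  let u : A →ₗ[Γ(Y, V)] Γ(I.subscheme, m ⁻¹ᵁ V) := ρ.toLinearMap ∘ₗ A.val.toLinearMap
  obtain ⟨z, hz⟩ := hε 1
  rw [mul_one] at hz
  have hwΨ (y : R' ⊗[Γ(Y, V)] A) : Φ (u.lTensor R' y) =
      w.appTop (Ψ (Algebra.TensorProduct.map (.id R' R') A.val y)) := by
    induction y with
    | zero => simp
    | add a b ha hb => simp only [map_add, ha, hb]
    | tmul r a =>
      have h1 : Φ (u.lTensor R' (r ⊗ₜ a)) = Φ (r ⊗ₜ 1) * Φ (1 ⊗ₜ σ a.1) := by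
        rw [← map_mul]
        simp only [u, ρ, LinearMap.lTensor_tmul, Algebra.TensorProduct.tmul_mul_tmul, mul_one, one_mul]
        rfl
      have h2 : Ψ (Algebra.TensorProduct.map (.id R' R') A.val (r ⊗ₜ a)) =
          Ψ (r ⊗ₜ 1) * Ψ (1 ⊗ₜ a.1) := by
        rw [← map_mul]
        simp
      rw [h1, h2, map_mul, hΦ₁, hΦ₂, hΨ₁, hΨ₂, hw₃, hw₄]
  -- The base change of the complement of `U` misses `W`, so it maps into `W'`, where `ε = 0`.
  have hwε : w.appTop ε = 0 := by
    have hwW : ⊤ ≤ w ⁻¹ᵁ W' := by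
      intro y _
      have : w y ∈ W ⊔ W' := hWW'.sup_eq_top.ge trivial
      refine this.resolve_left fun h ↦ ?_
      have h3 := hWU h
      have h4 : pullback.fst f t (w y) = ι (pullback.fst m t y) := by
        rw [← Scheme.Hom.comp_apply, hw₁, Scheme.Hom.comp_apply]
      have h5 : ι (pullback.fst m t y) ∈ (U : Set X)ᶜ := hι.le ⟨_, rfl⟩
      exact h5 (h4 ▸ h3)
    have : w.appTop = (pullback f t).presheaf.map (homOfLE (le_top : W' ≤ ⊤)).op ≫
        w.appLE W' ⊤ hwW := by
      rw [Scheme.Hom.map_appLE]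
      exact Scheme.Hom.app_eq_appLE ..
    rw [this, CommRingCat.comp_apply]
    erw [hε₂]
    rw [map_zero]
  obtain ⟨s, hs, hxs⟩ := exists_mem_ker_mem_basicOpen A u _ hp Ψ hΨ₂ v z
    (by rw [hz]; exact mem_basicOpen_of_map_eq_one ε hε₁ hvW)
    (hΦ (by rw [hwΨ, hz, hwε, map_zero]))
  refine ⟨s.1, s.2, hvx ▸ hxs, fun y hy ↦ ?_⟩
  by_contra hyU
  obtain ⟨y', rfl⟩ := hι.ge hyU
  have : y' ∈ ι ⁻¹ᵁ X.basicOpen s.1 := hy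
  rw [Scheme.preimage_basicOpen] at this
  have h0 : ι.app (f ⁻¹ᵁ V) s.1 = 0 := hs
  erw [h0, Scheme.basicOpen_zero] at this
  exact this

/-! ### Relative spectrum of a presheaf of integral subrings. -/

/-- A presheaf of subrings of `f_* 𝒪_X` containing the image of `𝒪_Y`. -/
structure SubringPresheaf {X Y : Scheme.{u}} (f : X ⟶ Y) where
  obj (U : Y.Opens) : Subring Γ(X, f ⁻¹ᵁ U)
  map_mem {U V : Y.Opens} (h : U ≤ V) (t : Γ(X, f ⁻¹ᵁ V)) (ht : t ∈ obj V) :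
    X.presheaf.map (homOfLE (f.preimage_mono h)).op t ∈ obj U
  app_mem (U : Y.Opens) (r : Γ(Y, U)) : f.app U r ∈ obj U
  isIntegralElem (U : Y.Opens) (t : Γ(X, f ⁻¹ᵁ U)) (ht : t ∈ obj U) : (f.app U).hom.IsIntegralElem t
  exists_pow_mul {U : Y.Opens} (hU : IsAffineOpen U) (r : Γ(Y, U))
    (t : Γ(X, f ⁻¹ᵁ Y.basicOpen r)) (ht : t ∈ obj (Y.basicOpen r)) :
    ∃ (n : ℕ), ∃ t' ∈ obj U,
      X.presheaf.map (homOfLE (f.preimage_mono (Y.basicOpen_le r))).op t' =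
        X.presheaf.map (homOfLE (f.preimage_mono (Y.basicOpen_le r))).op (f.app U r) ^ n * t

namespace SubringPresheaf

variable {X Y : Scheme.{u}} {f : X ⟶ Y} (E : SubringPresheaf f)

/-- The functor of sections. -/
noncomputable def functor : Y.Opensᵒᵖ ⥤ CommRingCat.{u} where
  obj U := .of (E.obj U.unop)
  map {V U} i := CommRingCat.ofHom
    ((X.presheaf.map (homOfLE (f.preimage_mono i.unop.le)).op).hom.restrict _ _
      fun x hx ↦ E.map_mem i.unop.le x hx)
  map_id U := by
    ext x
    exact congr($(X.presheaf.map_id _) x.1)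
  map_comp i j := by
    ext x
    exact congr($(X.presheaf.map_comp (homOfLE (f.preimage_mono i.unop.le)).op
      (homOfLE (f.preimage_mono j.unop.le)).op) x.1)

/-- The structure map from `𝒪_Y`. -/
noncomputable def fromBase : Y.presheaf ⟶ E.functor where
  app U := CommRingCat.ofHom ((f.app U.unop).hom.codRestrict _ (E.app_mem U.unop))
  naturality {U V} i := by ext x; exact Subtype.ext congr($(f.naturality i) x)

/-- The inclusion into the sections of `X`. -/
noncomputable def incl (U : Y.Opens) : CommRingCat.of (E.obj U) ⟶ Γ(X, f ⁻¹ᵁ U) :=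
  CommRingCat.ofHom (E.obj U).subtype

open Scheme AffineZariskiSite

/-- This is quasi-coherence. Numerators exist by `exists_pow_mul`; sections vanishing on the basic
open are killed by a power of `r` because this holds in the ambient sections of `X`. -/
theorem coequifibered [QuasiCompact f] [QuasiSeparated f] :
    NatTrans.Coequifibered ((toOpensFunctor Y).op.whiskerLeft E.fromBase) := by
  refine coequifibered_iff_forall_isLocalizationAway.mpr fun U r ↦ ?_
  let φ : E.obj U.1 →+* E.obj (Y.basicOpen r) :=
    (E.functor.map (homOfLE (Y.basicOpen_le r)).op).hom
  let r' : E.obj U.1 := ⟨f.app U.1 r, E.app_mem _ r⟩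
  have hr : φ r' = ⟨f.app _ (Y.presheaf.map (homOfLE (Y.basicOpen_le r)).op r), E.app_mem _ _⟩ :=
    Subtype.ext congr($(f.naturality (homOfLE (Y.basicOpen_le r)).op) r).symm
  suffices h : @IsLocalization _ _ (Submonoid.powers r') (E.obj (Y.basicOpen r)) _ φ.toAlgebra from h
  let _ := φ.toAlgebra
  refine ⟨⟨?_, ?_, ?_⟩⟩
  · rintro ⟨_, n, rfl⟩
    change IsUnit (φ (r' ^ n))
    rw [map_pow, hr]
    refine IsUnit.pow n ?_
    exact (RingedSpace.isUnit_res_basicOpen _ r).map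
      ((f.app (Y.basicOpen r)).hom.codRestrict _ (E.app_mem _))
  · intro t
    obtain ⟨n, t', ht', h⟩ := E.exists_pow_mul U.2 r t.1 t.2
    refine ⟨(⟨t', ht'⟩, ⟨r' ^ n, n, rfl⟩), ?_⟩
    change t * φ (r' ^ n) = φ ⟨t', ht'⟩
    refine Subtype.ext ?_
    refine .trans ?_ h.symm
    rw [map_pow, mul_comm]
    rfl
  · intro a b hab
    have hab' : φ (a - b) = 0 := by
      rw [map_sub, sub_eq_zero]
      exact hab
    have h1 : X.presheaf.map (homOfLE (f.preimage_mono (Y.basicOpen_le r))).op (a.1 - b.1) = 0 :=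
      congr($(hab').1)
    have h2 : X.presheaf.map (homOfLE (X.basicOpen_le (f.app U.1 r))).op (a.1 - b.1) = 0 := by
      have : homOfLE (X.basicOpen_le (f.app U.1 r)) =
        homOfLE (f.preimage_basicOpen r).ge ≫ homOfLE (f.preimage_mono (Y.basicOpen_le r)) := rfl
      rw [this, op_comp, X.presheaf.map_comp, CommRingCat.comp_apply, h1, map_zero]
    have := isLocalization_basicOpen_of_qcqs (f.isCompact_preimage U.2.isCompact)
        (f.isQuasiSeparated_preimage U.2.isQuasiSeparated) (f.app _ r)
    obtain ⟨⟨_, n, rfl⟩, hc⟩ := (IsLocalization.map_eq_zero_iff (Submonoid.powers (f.app U.1 r))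
      Γ(X, X.basicOpen (f.app U.1 r)) (a.1 - b.1)).mp h2
    refine ⟨⟨r' ^ n, n, rfl⟩, Subtype.ext ?_⟩
    rw [mul_sub, sub_eq_zero] at hc
    exact hc

variable [QuasiCompact f] [QuasiSeparated f]

/-- The gluing data of the relative spectrum. -/
noncomputable def glueData := relativeGluingData E.coequifibered

instance : (E.glueData.functor ⋙ Scheme.forget).IsLocallyDirected :=
  Cover.RelativeGluingData.instIsLocallyDirectedI₀CompFunctorForgetOfIsThin ..

/-- The relative spectrum. -/
noncomputable def spec : Scheme.{u} := E.glueData.glued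

/-- The affine charts of the relative spectrum. -/
noncomputable def chart (U : Y.affineOpens) : Spec (.of (E.obj U.1)) ⟶ E.spec :=
  E.glueData.cover.f U

/-- The structure morphism of the relative spectrum. -/
noncomputable def toBase : E.spec ⟶ Y := E.glueData.toBase

instance (U : Y.affineOpens) : IsOpenImmersion (E.chart U) :=
  E.glueData.cover.map_prop U

theorem chart_toBase (U : Y.affineOpens) :
    E.chart U ≫ E.toBase = Spec.map (E.fromBase.app (.op U.1)) ≫ U.2.fromSpec :=
  colimit.ι_desc _ _

theorem toBase_preimage (U : Y.affineOpens) : E.toBase ⁻¹ᵁ U.1 = (E.chart U).opensRange := by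
  refine Eq.trans ?_ (E.glueData.toBase_preimage_eq_opensRange_ι U)
  exact congr(E.toBase ⁻¹ᵁ $(U.1.opensRange_ι.symm))

theorem isAffineOpen_toBase_preimage (U : Y.affineOpens) : IsAffineOpen (E.toBase ⁻¹ᵁ U.1) := by
  rw [toBase_preimage]
  exact isAffineOpen_opensRange _

/-- The inclusion of the subrings into the integral closures. -/
noncomputable def toIntegral : E.functor ⟶ f.normalizationDiagram where
  app U :=
    letI := (f.app U.unop).hom.toAlgebra
    CommRingCat.ofHom ((E.obj U.unop).subtype.codRestrict
      (integralClosure Γ(Y, U.unop) Γ(X, f ⁻¹ᵁ U.unop)) fun t ↦ E.isIntegralElem U.unop t.1 t.2)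
  naturality _ _ _ := rfl

/-- The morphism from the normalization to the relative spectrum. -/
noncomputable def ofNormalization : f.normalization ⟶ E.spec :=
  colimMap (Functor.whiskerRight
    (Functor.whiskerLeft (toOpensFunctor Y).op E.toIntegral).rightOp Scheme.Spec)

theorem chart_ofNormalization (U : Y.affineOpens) :
    f.normalizationOpenCover.f U ≫ E.ofNormalization =
      Spec.map (E.toIntegral.app (.op U.1)) ≫ E.chart U :=
  ι_colimMap _ _

/-- The morphism from `X` to the relative spectrum. -/
noncomputable def ofTotal : X ⟶ E.spec := f.toNormalization ≫ E.ofNormalization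

/-- On a chart the detour through the normalization is invisible: the subring sits in the integral
closure, which sits in the sections of `X`. -/
theorem ι_ofTotal (U : Y.affineOpens) : (f ⁻¹ᵁ U.1).ι ≫ E.ofTotal =
    (f ⁻¹ᵁ U.1).toSpecΓ ≫ Spec.map (E.incl U.1) ≫ E.chart U := by
  refine (f.ι_toNormalization_assoc U E.ofNormalization).trans ?_
  refine (congr((f ⁻¹ᵁ U.1).toSpecΓ ≫ Spec.map _ ≫ $(E.chart_ofNormalization U))).trans ?_
  refine congr((f ⁻¹ᵁ U.1).toSpecΓ ≫ $(?_))
  exact (Spec.map_comp_assoc (E.toIntegral.app (.op U.1)) _ _).symm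

theorem toSpecΓ_SpecMap_app_fromSpec {X Y : Scheme.{u}} (f : X ⟶ Y) {U : Y.Opens}
    (hU : IsAffineOpen U) :
    (f ⁻¹ᵁ U).toSpecΓ ≫ Spec.map (f.app U) ≫ hU.fromSpec = (f ⁻¹ᵁ U).ι ≫ f := by
  simp

theorem ofTotal_toBase : E.ofTotal ≫ E.toBase = f := by
  refine Scheme.Cover.hom_ext (X.openCoverOfIsOpenCover _
    (.comap (iSup_affineOpens_eq_top Y) f.base.1)) _ _ fun U ↦ ?_
  suffices h : ∀ U : Y.affineOpens, (f ⁻¹ᵁ U.1).ι ≫ E.ofTotal ≫ E.toBase = (f ⁻¹ᵁ U.1).ι ≫ f from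
    h U
  intro U
  rw [← Category.assoc, ι_ofTotal, Category.assoc, Category.assoc, chart_toBase]
  refine Eq.trans ?_ (toSpecΓ_SpecMap_app_fromSpec f U.2)
  exact congr((f ⁻¹ᵁ U.1).toSpecΓ ≫
    $((Spec.map_comp_assoc (E.fromBase.app (.op U.1)) (E.incl U.1) _).symm))

theorem le_preimage (U : Y.Opens) : f ⁻¹ᵁ U ≤ E.ofTotal ⁻¹ᵁ (E.toBase ⁻¹ᵁ U) := by
  rw [← Scheme.Hom.comp_preimage, ofTotal_toBase]

/-- The sections of the relative spectrum over an affine open. -/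
noncomputable def sections (U : Y.affineOpens) :
    Γ(E.spec, E.toBase ⁻¹ᵁ U.1) ⟶ .of (E.obj U.1) :=
  (E.chart U).appLE (E.toBase ⁻¹ᵁ U.1) ⊤ (by
    rw [toBase_preimage]
    exact fun x _ ↦ ⟨x, rfl⟩) ≫ (Scheme.ΓSpecIso _).hom

instance (U : Y.affineOpens) : IsIso (E.sections U) := by
  have : IsIso ((E.chart U).appLE (E.toBase ⁻¹ᵁ U.1) ⊤ (by
      rw [toBase_preimage]
      exact fun x _ ↦ ⟨x, rfl⟩)) := by
    have := Scheme.Hom.isIso_app (E.chart U) (E.toBase ⁻¹ᵁ U.1) (E.toBase_preimage U).le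
    rw [Scheme.Hom.appLE]
    have : IsIso (homOfLE (show ⊤ ≤ E.chart U ⁻¹ᵁ E.toBase ⁻¹ᵁ U.1 by
        rw [toBase_preimage]
        exact fun x _ ↦ ⟨x, rfl⟩)) :=
      ⟨homOfLE le_top, Subsingleton.elim _ _, Subsingleton.elim _ _⟩
    infer_instance
  unfold sections
  infer_instance

/-- Identifies pullback of sections along `X → E.spec` with a subring inclusion; injectivity and the
range in `exists_factorization` are read off from it. -/
theorem sections_incl (U : Y.affineOpens) :
    E.sections U ≫ E.incl U.1 =
      E.ofTotal.appLE (E.toBase ⁻¹ᵁ U.1) (f ⁻¹ᵁ U.1) (E.le_preimage _) := by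
  have h1 : (E.chart U).appLE (E.toBase ⁻¹ᵁ U.1) ⊤ (by
      rw [toBase_preimage]
      exact fun x _ ↦ ⟨x, rfl⟩) ≫
        (Spec.map (E.incl U.1)).appTop ≫ (f ⁻¹ᵁ U.1).toSpecΓ.appTop =
      ((f ⁻¹ᵁ U.1).toSpecΓ ≫ Spec.map (E.incl U.1) ≫ E.chart U).appLE (E.toBase ⁻¹ᵁ U.1) ⊤ (by
        rw [← ι_ofTotal]
        exact fun x _ ↦ E.le_preimage _ x.2) := by
    have := appLE_comp_appTop ((f ⁻¹ᵁ U.1).toSpecΓ ≫ Spec.map (E.incl U.1)) (E.chart U)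
      (E.toBase ⁻¹ᵁ U.1) (by
      rw [toBase_preimage]
      exact fun x _ ↦ ⟨x, rfl⟩) (by
        rw [Category.assoc, ← ι_ofTotal]
        exact fun x _ ↦ E.le_preimage _ x.2)
    simp only [Category.assoc, Scheme.Hom.comp_appTop] at this
    exact this
  have h2 : E.ofTotal.appLE (E.toBase ⁻¹ᵁ U.1) (f ⁻¹ᵁ U.1) (E.le_preimage _) ≫
      (f ⁻¹ᵁ U.1).topIso.inv = ((f ⁻¹ᵁ U.1).ι ≫ E.ofTotal).appLE (E.toBase ⁻¹ᵁ U.1) ⊤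
        (fun (x : (f ⁻¹ᵁ U.1).toScheme) _ ↦ E.le_preimage _ x.2) := by
    rw [← Scheme.Hom.appLE_comp_appLE _ _ _ (f ⁻¹ᵁ U.1) ⊤ (E.le_preimage _)
      (fun (x : (f ⁻¹ᵁ U.1).toScheme) _ ↦ x.2)]
    congr 1
    simp only [Scheme.Opens.topIso_inv, Scheme.Hom.appLE, Scheme.Opens.ι_app]
    exact X.presheaf.map_comp _ _
  rw [← cancel_mono (f ⁻¹ᵁ U.1).topIso.inv, h2]
  simp only [ι_ofTotal]
  rw [← h1, Scheme.Opens.toSpecΓ_appTop]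
  simp only [sections, Category.assoc]
  congr 1
  rw [← Category.assoc, ← Category.assoc, Scheme.ΓSpecIso_naturality]

/-- A quasi-compact and quasi-separated morphism factors through the relative spectrum of any
presheaf of integral subalgebras which is compatible with localization. -/
theorem exists_factorization : ∃ (Z : Scheme.{u}) (i : X ⟶ Z) (h : Z ⟶ Y), i ≫ h = f ∧
    ∀ U : Y.Opens, IsAffineOpen U → IsAffineOpen (h ⁻¹ᵁ U) ∧ ∃ e : f ⁻¹ᵁ U ≤ i ⁻¹ᵁ h ⁻¹ᵁ U,
      Function.Injective (i.appLE (h ⁻¹ᵁ U) (f ⁻¹ᵁ U) e) ∧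
      (i.appLE (h ⁻¹ᵁ U) (f ⁻¹ᵁ U) e).hom.range = E.obj U := by
  refine ⟨E.spec, E.ofTotal, E.toBase, E.ofTotal_toBase, fun U hU ↦
    ⟨E.isAffineOpen_toBase_preimage ⟨U, hU⟩, E.le_preimage U, ?_, ?_⟩⟩
  · rw [← E.sections_incl ⟨U, hU⟩]
    have := (ConcreteCategory.bijective_of_isIso (E.sections ⟨U, hU⟩)).1
    exact Subtype.val_injective.comp this
  · rw [← E.sections_incl ⟨U, hU⟩]
    have := (ConcreteCategory.bijective_of_isIso (E.sections ⟨U, hU⟩)).2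
    ext t
    constructor
    · rintro ⟨y, rfl⟩
      exact (E.sections ⟨U, hU⟩ y).2
    · intro ht
      obtain ⟨y, hy⟩ := this ⟨t, ht⟩
      exact ⟨y, congr($(hy).1)⟩

end SubringPresheaf

/-! ### Detecting sections by an open set and a thickened complement. -/

section Restriction

variable {X Y : Scheme.{u}}

/-- Restriction of sections, as a ring homomorphism. -/
def res {U V : X.Opens} (h : U ≤ V) : Γ(X, V) →+* Γ(X, U) := (X.presheaf.map (homOfLE h).op).hom

theorem res_res {U V W : X.Opens} (h : U ≤ V) (h' : V ≤ W) (t : Γ(X, W)) :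
    res h (res h' t) = res (h.trans h') t :=
  congr($(X.presheaf.map_comp (homOfLE h').op (homOfLE h).op) t).symm

theorem app_res (f : X ⟶ Y) {U V : Y.Opens} (h : U ≤ V) (t : Γ(Y, V)) :
    f.app U (res h t) = res (f.preimage_mono h) (f.app V t) :=
  congr($(f.naturality (homOfLE h).op) t)

theorem basicOpen_res {U V : X.Opens} (h : U ≤ V) (t : Γ(X, V)) :
    X.basicOpen (res h t) = U ⊓ X.basicOpen t :=
  X.basicOpen_res t (homOfLE h).op

theorem exists_pow_mul_eq_zero_of_res_eq_zero {U W : X.Opens} (hU : IsCompact (U : Set X))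
    (g t : Γ(X, U)) (hW : W = X.basicOpen g) (hWU : W ≤ U) (h : res hWU t = 0) :
    ∃ n : ℕ, g ^ n * t = 0 := by
  subst hW
  exact exists_pow_mul_eq_zero_of_res_basicOpen_eq_zero_of_isCompact X hU t g h

theorem eq_zero_of_forall_exists_res_eq_zero {U : X.Opens} (t : Γ(X, U))
    (h : ∀ x ∈ U, ∃ (W : X.Opens) (hW : W ≤ U), x ∈ W ∧ res hW t = 0) : t = 0 := by
  choose W hW hx hres using h
  refine X.IsSheaf.section_ext fun x hx' ↦ ⟨W x hx', hW x hx', hx x hx', ?_⟩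
  refine (hres x hx').trans ?_
  exact (map_zero (res (hW x hx'))).symm

theorem app_eq_zero_of_comp_eq {Z : Scheme.{u}} {g : X ⟶ Y} {h : Y ⟶ Z} {q : X ⟶ Z}
    (e : g ≫ h = q) {U : Z.Opens} (t : Γ(Z, U)) (ht : h.app U t = 0) : q.app U t = 0 := by
  subst e
  have h1 := Scheme.Hom.comp_app g h U
  have h2 : (g ≫ h).app U t = g.app (h ⁻¹ᵁ U) (h.app U t) := congr($h1 t)
  exact h2.trans (congr(g.app (h ⁻¹ᵁ U) $ht).trans (map_zero (g.app (h ⁻¹ᵁ U)).hom))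

end Restriction

/-- As `K` and `I` are finitely generated, some `I ^ m` annihilates `K`. Artin–Rees gives `I ^ (k +
m) ⊓ K = I ^ m (I ^ k ⊓ K)`, which is then zero. -/
theorem exists_pow_inf_eq_bot {B : Type*} [CommRing B] [IsNoetherianRing B] (K I : Ideal B)
    (h : ∀ a ∈ I, ∀ b ∈ K, ∃ n : ℕ, a ^ n * b = 0) : ∃ n : ℕ, I ^ n ⊓ K = ⊥ := by
  obtain ⟨s, hs⟩ := IsNoetherian.noetherian K
  have hI : I ≤ (Module.annihilator B K).radical := by
    intro a ha
    choose! n hn using fun b ↦ h a ha b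
    refine ⟨s.sup n, ?_⟩
    rw [Submodule.mem_annihilator, ← hs]
    intro b hb
    induction hb using Submodule.span_induction with
    | mem b hb =>
      obtain ⟨k, hk⟩ := Nat.exists_eq_add_of_le (Finset.le_sup (f := n) hb)
      have hbK : b ∈ K := hs ▸ Submodule.subset_span hb
      rw [hk, pow_add, smul_eq_mul, mul_right_comm, hn b hbK, zero_mul]
    | zero => simp
    | add b c _ _ hb hc => rw [smul_add, hb, hc, add_zero]
    | smul r b _ hb => rw [smul_comm, hb, smul_zero]
  obtain ⟨m, hm⟩ := Ideal.exists_pow_le_of_le_radical_of_fg hI (IsNoetherian.noetherian I)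
  obtain ⟨k, hk⟩ := Ideal.exists_pow_inf_eq_pow_smul I (M := B) K
  refine ⟨k + m, ?_⟩
  have := hk (k + m) (by lia)
  rw [smul_eq_mul, Ideal.mul_top] at this
  rw [this, Nat.add_sub_cancel_left, eq_bot_iff]
  refine (Submodule.smul_le.mpr fun r hr b hb ↦ ?_ :
    I ^ m • (I ^ k • ⊤ ⊓ K : Ideal B) ≤ ⊥)
  have hb : b ∈ K := hb.2
  exact Submodule.mem_annihilator.mp (hm hr) b hb

/-- The closed subscheme of an affine open defined by a power of an ideal vanishing on the complement
of `O`. -/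
theorem exists_compactSpace_preimage_eq_bot {X : Scheme.{u}} (O : X.Opens) {W : X.Opens}
    (hW : IsAffineOpen W) (n : ℕ) :
    ∃ (Q : Scheme.{u}) (_ : CompactSpace Q) (q : Q ⟶ X), q ⁻¹ᵁ O = ⊥ ∧ q ⁻¹ᵁ W = ⊤ ∧
      ∀ b, q.app W b = 0 →
        b ∈ PrimeSpectrum.vanishingIdeal ((hW.fromSpec ⁻¹ᵁ O).1ᶜ : Set (Spec Γ(X, W))) ^ n := by
  let C : Set (PrimeSpectrum Γ(X, W)) := (hW.fromSpec ⁻¹ᵁ O).1ᶜ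
  have hC : IsClosed C := (hW.fromSpec ⁻¹ᵁ O).2.isClosed_compl
  let I : Ideal Γ(X, W) := PrimeSpectrum.vanishingIdeal C
  let q := specToScheme hW (Γ(X, W) ⧸ I ^ n)
  refine ⟨_, inferInstance, q, ?_, specToScheme_preimage hW _, fun b hb ↦ ?_⟩
  rotate_left
  · have h1 : q.appLE W ⊤ (specToScheme_preimage hW (Γ(X, W) ⧸ I ^ n)).ge b = 0 := by
      rw [Scheme.Hom.appLE, CommRingCat.comp_apply, hb, map_zero]
    rw [specToScheme_appLE, CommRingCat.comp_apply] at h1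
    refine Ideal.Quotient.eq_zero_iff_mem.mp ?_
    refine (ConcreteCategory.bijective_of_isIso
      (Scheme.ΓSpecIso (.of (Γ(X, W) ⧸ I ^ n))).inv).1 ?_
    exact h1.trans (map_zero _).symm
  · rw [eq_bot_iff]
    intro x hx
    let y : PrimeSpectrum Γ(X, W) :=
      Spec.map (CommRingCat.ofHom (algebraMap Γ(X, W) (Γ(X, W) ⧸ I ^ n))) x
    have h1 : y ∉ C := not_not.mpr hx
    refine h1 ?_
    rw [← hC.closure_eq, ← PrimeSpectrum.zeroLocus_vanishingIdeal_eq_closure,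
      PrimeSpectrum.mem_zeroLocus]
    intro a ha
    refine y.2.mem_of_pow_mem n ?_
    change Ideal.Quotient.mk (I ^ n) (a ^ n) ∈ x.asIdeal
    rw [Ideal.Quotient.eq_zero_iff_mem.mpr (Ideal.pow_mem_pow ha n)]
    exact x.asIdeal.zero_mem

/-- On an affine noetherian open subset `W`, a power of the ideal of the complement of `O` defines
a closed subscheme disjoint from `O` which together with `O` detects sections. -/
theorem exists_detecting_morphism_of_isAffineOpen {X : Scheme.{u}} [IsNoetherian X] (O : X.Opens)
    {W : X.Opens} (hW : IsAffineOpen W) :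
    ∃ (Q : Scheme.{u}) (_ : CompactSpace Q) (q : Q ⟶ X), q ⁻¹ᵁ O = ⊥ ∧
      ∀ (U : X.Opens) (t : Γ(X, U)), res (inf_le_left : U ⊓ O ≤ U) t = 0 → q.app U t = 0 →
        res (inf_le_left : U ⊓ W ≤ U) t = 0 := by
  have hB : IsNoetherianRing Γ(X, W) := IsLocallyNoetherian.component_noetherian ⟨W, hW⟩
  let K : Ideal Γ(X, W) := RingHom.ker (res (inf_le_left : W ⊓ O ≤ W))
  let C : Set (PrimeSpectrum Γ(X, W)) := (hW.fromSpec ⁻¹ᵁ O).1ᶜ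
  have hC : IsClosed C := (hW.fromSpec ⁻¹ᵁ O).2.isClosed_compl
  let I : Ideal Γ(X, W) := PrimeSpectrum.vanishingIdeal C
  have hI (a) (ha : a ∈ I) : X.basicOpen a ≤ O := by
    intro x hx
    have hxW := X.basicOpen_le a hx
    by_contra hxO
    have h1 : hW.primeIdealOf ⟨x, hxW⟩ ∈ C := by
      intro h
      refine hxO ?_
      have : hW.fromSpec (hW.primeIdealOf ⟨x, hxW⟩) ∈ O := h
      rwa [hW.fromSpec_primeIdealOf] at this
    have h2 := (PrimeSpectrum.mem_vanishingIdeal _ _).mp ha _ h1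
    have h3 : hW.fromSpec (hW.primeIdealOf ⟨x, hxW⟩) ∈ X.basicOpen a := by
      rwa [hW.fromSpec_primeIdealOf]
    have h4 : hW.primeIdealOf ⟨x, hxW⟩ ∈ hW.fromSpec ⁻¹ᵁ X.basicOpen a := h3
    rw [hW.fromSpec_preimage_basicOpen] at h4
    exact h4 h2
  -- For `a ∈ I` the basic open of `a` lies in `O`, so a section in `K` vanishes there and is killed
  -- by a power of `a`.
  obtain ⟨n, hn⟩ := exists_pow_inf_eq_bot K I fun a ha b hb ↦ by
    have h1 : X.basicOpen a ≤ W := X.basicOpen_le a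
    refine exists_pow_mul_eq_zero_of_res_eq_zero hW.isCompact a b rfl h1 ?_
    have : res h1 b = res (le_inf h1 (hI a ha)) (res inf_le_left b) := (res_res ..).symm
    rw [this, (hb : res inf_le_left b = 0), map_zero]
  obtain ⟨Q, hQ, q, hqO, hqW, hqI⟩ := exists_compactSpace_preimage_eq_bot O hW n
  refine ⟨Q, hQ, q, hqO, fun U t htO htq ↦ ?_⟩
  refine eq_zero_of_forall_exists_res_eq_zero _ fun x ⟨hxU, hxW⟩ ↦ ?_
  obtain ⟨b, hbU, hxb⟩ := hW.exists_basicOpen_le ⟨x, hxU⟩ hxW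
  have hbW := X.basicOpen_le b
  refine ⟨X.basicOpen b, le_inf hbU hbW, hxb, ?_⟩
  rw [res_res]
  have hloc := hW.isLocalization_basicOpen b
  obtain ⟨⟨β, ⟨_, m, rfl⟩⟩, hβ⟩ := IsLocalization.surj (Submonoid.powers b)
    (res hbU t)
  have hβ' : res hbU t * res hbW (b ^ m) = res hbW β := hβ
  have h1 : res hbW β = 0 → res hbU t = 0 := by
    intro h
    rw [h] at hβ'
    have hu : IsUnit (res hbW (b ^ m)) := by
      rw [map_pow]
      exact (RingedSpace.isUnit_res_basicOpen _ b).pow m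
    exact (hu.mul_left_eq_zero).mp hβ'
  refine h1 ?_
  -- Vanishing of `t` on `O` puts a multiple of its numerator `β` in `K`, and vanishing on `Q` puts
  -- one in `I ^ n`. As `I ^ n ⊓ K = ⊥`, a power of `b` kills `β`.
  have hK : ∃ k, b ^ k * β ∈ K := by
    let b' := res (inf_le_left : W ⊓ O ≤ W) b
    obtain ⟨k, hk⟩ := exists_pow_mul_eq_zero_of_res_eq_zero (X := X) (W := X.basicOpen b')
      (NoetherianSpace.isCompact _) b' (res (inf_le_left : W ⊓ O ≤ W) β) rfl (X.basicOpen_le _) (by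
        have e : X.basicOpen b' = (W ⊓ O) ⊓ X.basicOpen b := X.basicOpen_res _ _
        have e1 : X.basicOpen b' ≤ X.basicOpen b := e.le.trans inf_le_right
        have e2 : X.basicOpen b' ≤ U ⊓ O :=
          le_inf (e1.trans hbU) (e.le.trans (inf_le_left.trans inf_le_right))
        have : res e1 (res hbU t) = 0 := by
          rw [res_res, ← res_res e2 inf_le_left, htO, map_zero]
        rw [res_res, ← res_res e1 hbW, ← hβ', map_mul, this, zero_mul])
    refine ⟨k, ?_⟩
    rw [RingHom.mem_ker, map_mul, map_pow]
    exact hk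
  have hqb : ∃ k, b ^ k * β ∈ I ^ n := by
    obtain ⟨k, hk⟩ := exists_pow_mul_eq_zero_of_res_eq_zero (W := q ⁻¹ᵁ X.basicOpen b)
      (hqW ▸ isCompact_univ) (q.app W b) (q.app W β) (q.preimage_basicOpen b)
      (q.preimage_mono hbW) (by
        rw [← app_res q hbW, ← hβ', map_mul, app_res, htq, map_zero, zero_mul])
    refine ⟨k, hqI _ ?_⟩
    rw [map_mul, map_pow]
    exact hk
  obtain ⟨k, hk⟩ := hK
  obtain ⟨l, hl⟩ := hqb
  have h0 : b ^ (k + l) * β ∈ I ^ n ⊓ K := by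
    refine ⟨?_, ?_⟩
    · rw [pow_add, mul_assoc]
      exact Ideal.mul_mem_left _ _ hl
    · rw [pow_add, mul_comm (b ^ k), mul_assoc]
      exact Ideal.mul_mem_left _ _ hk
  rw [hn, Ideal.mem_bot] at h0
  have h2 := congr(res hbW $h0)
  rw [map_mul, map_zero, map_pow] at h2
  exact (((RingedSpace.isUnit_res_basicOpen _ b).pow _).mul_right_eq_zero).mp h2

/-- The complement of an open subset of a noetherian scheme carries a closed subscheme structure
which together with the open subset detects sections. -/
theorem exists_detecting_morphism {X : Scheme.{u}} [IsNoetherian X] (O : X.Opens) :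
    ∃ (Q : Scheme.{u}) (_ : CompactSpace Q) (q : Q ⟶ X), q ⁻¹ᵁ O = ⊥ ∧
      ∀ (U : X.Opens) (t : Γ(X, U)), res (inf_le_left : U ⊓ O ≤ U) t = 0 → q.app U t = 0 →
        t = 0 := by
  let 𝒰 := X.affineCover.finiteSubcover
  choose Q hQ q hqO hq using fun j ↦
    exists_detecting_morphism_of_isAffineOpen O (isAffineOpen_opensRange (𝒰.f j))
  refine ⟨∐ Q, (sigmaMk Q).compactSpace, Sigma.desc q, ?_, fun U t htO htq ↦ ?_⟩
  · rw [eq_bot_iff]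
    intro x hx
    obtain ⟨⟨j, y⟩, rfl⟩ := (sigmaMk Q).surjective x
    rw [sigmaMk_mk] at hx
    have h1 : y ∈ (Sigma.ι Q j ≫ Sigma.desc q) ⁻¹ᵁ O := hx
    rw [Sigma.ι_desc, hqO] at h1
    exact h1.elim
  · refine eq_zero_of_forall_exists_res_eq_zero t fun x hx ↦ ?_
    refine ⟨U ⊓ (𝒰.f (𝒰.idx x)).opensRange, inf_le_left, ⟨hx, 𝒰.covers x⟩, ?_⟩
    refine hq _ U t htO ?_
    exact app_eq_zero_of_comp_eq (Sigma.ι_desc q (𝒰.idx x)) t htq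

/-! ### Finite algebras generated by extensions of integral sections. -/

section Extensions

variable {X Y Q : Scheme.{u}} (f : X ⟶ Y) {V : Y.Opens} (s : Γ(X, f ⁻¹ᵁ V)) (q : Q ⟶ X)

theorem isIntegralElem_res {U U' : Y.Opens} (h : U ≤ U') (t : Γ(X, f ⁻¹ᵁ U'))
    (ht : (f.app U').hom.IsIntegralElem t) :
    (f.app U).hom.IsIntegralElem (res (f.preimage_mono h) t) := by
  obtain ⟨p, hp, hpt⟩ := ht
  refine ⟨p.map (res h), hp.map _, ?_⟩
  rw [Polynomial.eval₂_map]
  have : (f.app U).hom.comp (res h) = (res (f.preimage_mono h)).comp (f.app U').hom :=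
    RingHom.ext fun r ↦ app_res f h r
  rw [this, ← Polynomial.hom_eval₂, hpt, map_zero]

/-- An integral section over a basic open extends after multiplication by a power. -/
theorem exists_isIntegralElem_res_eq [QuasiCompact f] [QuasiSeparated f] {U : Y.Opens}
    (hU : IsAffineOpen U) (r : Γ(Y, U)) (t : Γ(X, f ⁻¹ᵁ Y.basicOpen r))
    (ht : (f.app _).hom.IsIntegralElem t) :
    ∃ (n : ℕ) (t' : Γ(X, f ⁻¹ᵁ U)), (f.app U).hom.IsIntegralElem t' ∧
      res (f.preimage_mono (Y.basicOpen_le r)) t' =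
        res (f.preimage_mono (Y.basicOpen_le r)) (f.app U r) ^ n * t := by
  have h := Scheme.AffineZariskiSite.coequifibered_iff_forall_isLocalizationAway.mp
    f.coequifibered_normalizationDiagramMap ⟨U, hU⟩ r
  let _ := (f.app (Y.basicOpen r)).hom.toAlgebra
  let _ := (f.app U).hom.toAlgebra
  let φ := (f.normalizationDiagram.map (homOfLE (Y.basicOpen_le r)).op).hom
  let _ := φ.toAlgebra
  obtain ⟨⟨t', ⟨_, n, rfl⟩⟩, h'⟩ := @IsLocalization.surj _ _ _ _ _ φ.toAlgebra h
    (⟨t, ht⟩ : integralClosure Γ(Y, Y.basicOpen r) Γ(X, f ⁻¹ᵁ Y.basicOpen r))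
  refine ⟨n, t'.1, t'.2, ?_⟩
  have h2 := congr($(h').1)
  refine h2.symm.trans ?_
  refine (mul_comm _ _).trans ?_
  congr 1
  exact map_pow (res (f.preimage_mono (Y.basicOpen_le r))) (f.app U r) n

/-- The integral sections extending a multiple of `s` and vanishing on `Q`. -/
def extensions (U : Y.Opens) : Set Γ(X, f ⁻¹ᵁ U) :=
  {t | q.app _ t = 0 ∧ (f.app U).hom.IsIntegralElem t ∧ ∃ c : Γ(Y, U),
    res (f.preimage_mono (inf_le_left : U ⊓ V ≤ U)) t =
      f.app _ (res (inf_le_left : U ⊓ V ≤ U) c) *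
        res (f.preimage_mono (inf_le_right : U ⊓ V ≤ V)) s}

theorem res_mem_extensions {U U' : Y.Opens} (h : U ≤ U') (t : Γ(X, f ⁻¹ᵁ U'))
    (ht : t ∈ extensions f s q U') : res (f.preimage_mono h) t ∈ extensions f s q U := by
  obtain ⟨ht1, ht2, c, hc⟩ := ht
  refine ⟨?_, isIntegralElem_res f h t ht2, res h c, ?_⟩
  · rw [app_res, ht1, map_zero]
  · have h1 := congr(res (f.preimage_mono (inf_le_inf_right V h)) $hc)
    rw [map_mul, ← app_res f (inf_le_inf_right V h), res_res, res_res, res_res] at h1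
    rw [res_res, res_res]
    exact h1

theorem self_mem_extensions (hs : (f.app V).hom.IsIntegralElem s) (hq : q ⁻¹ᵁ f ⁻¹ᵁ V = ⊥) :
    s ∈ extensions f s q V := by
  refine ⟨?_, hs, 1, by simp⟩
  have : Subsingleton Γ(Q, q ⁻¹ᵁ f ⁻¹ᵁ V) := by
    rw [hq]
    infer_instance
  exact Subsingleton.elim _ _

/-- Extend `t` as an integral section first. The conditions on `Q` and on `U ⊓ V` then hold over the
basic open of `r`, so by compactness they hold on all of `U` after multiplication by further powers
of `r`. -/
theorem exists_extensions_res_eq [IsNoetherian X] [CompactSpace Q] [QuasiSeparated f] {U : Y.Opens}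
    (hU : IsAffineOpen U) (r : Γ(Y, U)) (t : Γ(X, f ⁻¹ᵁ Y.basicOpen r))
    (ht : t ∈ extensions f s q (Y.basicOpen r)) :
    ∃ (n : ℕ), ∃ t' ∈ extensions f s q U,
      res (f.preimage_mono (Y.basicOpen_le r)) t' =
        res (f.preimage_mono (Y.basicOpen_le r)) (f.app U r) ^ n * t := by
  obtain ⟨ht1, ht2, c, hc⟩ := ht
  obtain ⟨n, t', ht', h⟩ := exists_isIntegralElem_res_eq f hU r t ht2
  set ρ := f.app U r with hρ
  have hle := Y.basicOpen_le r
  obtain ⟨a, ha⟩ := exists_pow_mul_eq_zero_of_res_eq_zero (X := Q)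
    (W := q ⁻¹ᵁ f ⁻¹ᵁ Y.basicOpen r) (q.isCompact_preimage (NoetherianSpace.isCompact _))
    (q.app _ ρ) (q.app _ t') (by rw [f.preimage_basicOpen, q.preimage_basicOpen])
    (q.preimage_mono (f.preimage_mono hle)) (by
      rw [← app_res q (f.preimage_mono hle), h, map_mul, ht1, mul_zero])
  have hloc := hU.isLocalization_basicOpen r
  obtain ⟨⟨c', ⟨_, m, rfl⟩⟩, hc'⟩ := IsLocalization.surj (Submonoid.powers r) c
  have hc' : c * res hle (r ^ m) = res hle c' := hc'
  let i₁ := f.preimage_mono (inf_le_left : U ⊓ V ≤ U)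
  let i₂ := f.preimage_mono (inf_le_right : U ⊓ V ≤ V)
  let r₁ := res (inf_le_left : U ⊓ V ≤ U) r
  let ρ₁ := f.app _ r₁
  have hρ₁ : ρ₁ = res i₁ ρ := app_res f _ r
  have hD : Y.basicOpen r ⊓ V = Y.basicOpen r₁ := by
    rw [basicOpen_res]
    apply le_antisymm
    · exact le_inf (le_inf (inf_le_left.trans hle) inf_le_right) inf_le_left
    · exact le_inf inf_le_right (inf_le_left.trans inf_le_right)
  obtain ⟨b, hb⟩ := exists_pow_mul_eq_zero_of_res_eq_zero (W := f ⁻¹ᵁ (Y.basicOpen r ⊓ V))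
    (NoetherianSpace.isCompact _) ρ₁
    (ρ₁ ^ m * res i₁ t' - ρ₁ ^ n * f.app _ (res inf_le_left c') * res i₂ s)
    (by rw [hD, f.preimage_basicOpen]) (f.preimage_mono (inf_le_inf_right V hle)) (by
      have h1 := congr(res (f.preimage_mono (inf_le_left : Y.basicOpen r ⊓ V ≤ _)) $h)
      rw [map_mul, hc] at h1
      have h2 := congr(f.app _ (res (inf_le_left : Y.basicOpen r ⊓ V ≤ _) $hc'))
      simp only [map_mul, map_pow, res_res] at h1 h2
      simp only [map_mul, map_sub, map_pow, hρ₁, res_res, h1]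
      rw [← app_res f (inf_le_inf_right V hle), res_res, ← h2, hρ,
        ← app_res f (inf_le_left.trans hle)]
      ring)
  -- `n` extends `t`, `m` clears the denominator of `c`, `a` forces vanishing on `Q`, and `b` forces
  -- the multiplier identity on `U ⊓ V`.
  refine ⟨a + b + m + n, ρ ^ (a + b + m) * t', ⟨?_, ?_, r ^ (a + b + n) * c', ?_⟩, ?_⟩
  · rw [map_mul, map_pow, pow_add, pow_add, mul_comm (_ ^ a), mul_assoc, mul_assoc,
      mul_left_comm _ _ (q.app _ t'), ha, mul_zero, mul_zero]
  · rw [hρ, ← map_pow]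
    exact ((f.app U).hom.isIntegralElem_map).mul _ ht'
  · rw [mul_sub, sub_eq_zero] at hb
    simp only [map_mul, map_pow, ← hρ₁]
    change _ = ρ₁ ^ _ * _ * _
    linear_combination ρ₁ ^ a * hb
  · rw [map_mul, h, map_pow]
    ring

/-- An extension is determined by its multiplier `c`, since it vanishes on `Q`. The multipliers
generate a finitely generated ideal of `Γ(Y, U)`, and lifts of finitely many generating multipliers
span all extensions. -/
theorem exists_finite_span_extensions [IsNoetherian Y]
    (hq : ∀ (U : X.Opens) (t : Γ(X, U)), res (inf_le_left : U ⊓ f ⁻¹ᵁ V ≤ U) t = 0 →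
      q.app U t = 0 → t = 0) {U : Y.Opens} (hU : IsAffineOpen U) :
    ∃ F : Set Γ(X, f ⁻¹ᵁ U), F.Finite ∧ F ⊆ extensions f s q U ∧
      ∀ t ∈ extensions f s q U, t ∈ Subring.closure (Set.range (f.app U) ∪ F) := by
  have hnoeth : IsNoetherianRing Γ(Y, U) := IsLocallyNoetherian.component_noetherian ⟨U, hU⟩
  let C : Set Γ(Y, U) := {c | ∃ t : Γ(X, f ⁻¹ᵁ U), t ∈ extensions f s q U ∧
    res (f.preimage_mono (inf_le_left : U ⊓ V ≤ U)) t =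
      f.app _ (res (inf_le_left : U ⊓ V ≤ U) c) *
        res (f.preimage_mono (inf_le_right : U ⊓ V ≤ V)) s}
  obtain ⟨C', hC', hspan⟩ := (Submodule.fg_span_iff_fg_span_finset_subset C).mp
    (IsNoetherian.noetherian (Ideal.span C))
  choose! τ hτ hτ' using fun c (hc : c ∈ C) ↦ hc
  refine ⟨τ '' C', C'.finite_toSet.image τ, ?_, ?_⟩
  · rintro _ ⟨c, hc, rfl⟩
    exact hτ c (hC' hc)
  · intro t ht
    obtain ⟨ht1, ht2, c, hc⟩ := ht
    have hcC : c ∈ Ideal.span (C' : Set Γ(Y, U)) := by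
      have : c ∈ Ideal.span C := Ideal.subset_span ⟨t, ⟨ht1, ht2, c, hc⟩, hc⟩
      exact hspan.le this
    have key : ∀ c ∈ Ideal.span (C' : Set Γ(Y, U)),
        ∃ t' ∈ Subring.closure (Set.range (f.app U) ∪ τ '' C'), q.app _ t' = 0 ∧
          res (f.preimage_mono (inf_le_left : U ⊓ V ≤ U)) t' =
            f.app _ (res (inf_le_left : U ⊓ V ≤ U) c) *
            res (f.preimage_mono (inf_le_right : U ⊓ V ≤ V)) s := by
      intro c hc
      induction hc using Submodule.span_induction with
      | mem c hc =>
        exact ⟨τ c, Subring.subset_closure (.inr ⟨c, hc, rfl⟩), (hτ c (hC' hc)).1, hτ' c (hC' hc)⟩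
      | zero => exact ⟨0, zero_mem _, map_zero _, by simp⟩
      | add c d _ _ hc hd =>
        obtain ⟨t₁, h₁, h₁', h₁''⟩ := hc
        obtain ⟨t₂, h₂, h₂', h₂''⟩ := hd
        refine ⟨t₁ + t₂, add_mem h₁ h₂, by rw [map_add, h₁', h₂', add_zero], ?_⟩
        rw [map_add, h₁'', h₂'', map_add, map_add, add_mul]
      | smul r c _ hc =>
        obtain ⟨t₁, h₁, h₁', h₁''⟩ := hc
        refine ⟨f.app U r * t₁, mul_mem (Subring.subset_closure (.inl ⟨r, rfl⟩)) h₁,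
          by rw [map_mul, h₁', mul_zero], ?_⟩
        rw [map_mul, h₁'', smul_eq_mul, map_mul, map_mul, mul_assoc,
          app_res f inf_le_left r]
    obtain ⟨t', ht', ht'', h⟩ := key c hcC
    have : t - t' = 0 := by
      refine hq _ _ ?_ (by rw [map_sub, ht1, ht'', sub_zero])
      exact (map_sub (res _) t t').trans (sub_eq_zero.mpr (hc.trans h.symm))
    rw [sub_eq_zero.mp this]
    exact ht'

end Extensions

/-- Through the injection `j`, `C` is generated over `R` by finitely many integral elements. -/
theorem finite_of_range_eq_closure {R C G : Type*} [CommRing R] [CommRing C] [CommRing G]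
    (φ : R →+* C) (j : C →+* G) (hj : Function.Injective j) (F : Set G) (hF : F.Finite)
    (hint : ∀ x ∈ F, (j.comp φ).IsIntegralElem x)
    (h : j.range = Subring.closure (Set.range (j.comp φ) ∪ F)) : φ.Finite := by
  algebraize [φ]
  have hFj : F ⊆ j.range := by
    rw [h]
    exact fun x hx ↦ Subring.subset_closure (.inr hx)
  have hF' : (j ⁻¹' F).Finite := hF.preimage hj.injOn
  have hint' : ∀ c ∈ j ⁻¹' F, IsIntegral R c := by
    intro c hc
    obtain ⟨p, hp, hpc⟩ := hint _ hc
    refine ⟨p, hp, hj ?_⟩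
    rw [Polynomial.hom_eval₂, map_zero]
    exact hpc
  have htop : Algebra.adjoin R (j ⁻¹' F) = ⊤ := by
    rw [eq_top_iff]
    rintro c -
    have hle : Subring.closure (Set.range (j.comp φ) ∪ F) ≤
        (Algebra.adjoin R (j ⁻¹' F)).toSubring.map j := by
      rw [Subring.closure_le]
      rintro _ (⟨r, rfl⟩ | hx)
      · exact ⟨φ r, Subalgebra.algebraMap_mem _ r, rfl⟩
      · obtain ⟨c, rfl⟩ := hFj hx
        exact ⟨c, Algebra.subset_adjoin hx, rfl⟩
    obtain ⟨c', hc', e⟩ := hle (h.le ⟨c, rfl⟩)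
    exact hj e ▸ hc'
  have := fg_adjoin_of_finite hF' hint'
  rw [htop] at this
  exact ⟨this⟩

/-- A section over the preimage of an open subset together with a morphism that controls its
extensions. -/
structure ExtensionDatum {X Y : Scheme.{u}} (f : X ⟶ Y) where
  V : Y.Opens
  s : Γ(X, f ⁻¹ᵁ V)
  isIntegralElem : (f.app V).hom.IsIntegralElem s
  Q : Scheme.{u}
  compactSpace : CompactSpace Q
  q : Q ⟶ X
  preimage_eq_bot : q ⁻¹ᵁ f ⁻¹ᵁ V = ⊥
  eq_zero (U : X.Opens) (t : Γ(X, U)) : res (inf_le_left : U ⊓ f ⁻¹ᵁ V ≤ U) t = 0 →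
    q.app U t = 0 → t = 0

theorem exists_extensionDatum {X Y : Scheme.{u}} (f : X ⟶ Y) [IsNoetherian X] (V : Y.Opens)
    (s : Γ(X, f ⁻¹ᵁ V)) (hs : (f.app V).hom.IsIntegralElem s) :
    ∃ D : ExtensionDatum f, ∃ h : D.V = V, s = h ▸ D.s := by
  obtain ⟨Q, hQ, q, hq, h⟩ := exists_detecting_morphism (f ⁻¹ᵁ V)
  exact ⟨⟨V, s, hs, Q, hQ, q, hq, h⟩, rfl, rfl⟩

namespace ExtensionDatum

variable {X Y : Scheme.{u}} {f : X ⟶ Y} {ι : Type*} (D : ι → ExtensionDatum f)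

/-- The generators of the subalgebra attached to a family of extension data. -/
def generators (U : Y.Opens) : Set Γ(X, f ⁻¹ᵁ U) :=
  Set.range (f.app U) ∪ ⋃ i, extensions f (D i).s (D i).q U

theorem isIntegralElem_of_mem_closure (U : Y.Opens) (t : Γ(X, f ⁻¹ᵁ U))
    (ht : t ∈ Subring.closure (generators D U)) : (f.app U).hom.IsIntegralElem t := by
  induction ht using Subring.closure_induction with
  | mem t ht =>
    obtain ⟨r, rfl⟩ | ht := ht
    · exact (f.app U).hom.isIntegralElem_map
    · obtain ⟨i, hi⟩ := Set.mem_iUnion.mp ht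
      exact hi.2.1
  | zero => exact (f.app U).hom.isIntegralElem_zero
  | one => exact (f.app U).hom.isIntegralElem_one
  | add a b _ _ ha hb => exact ha.add _ hb
  | neg a _ ha => exact ha.neg _
  | mul a b _ _ ha hb => exact ha.mul _ hb

/-- The presheaf of subalgebras generated by the extensions of multiples of finitely many
integral sections. -/
noncomputable def subringPresheaf [IsNoetherian X] [QuasiSeparated f] : SubringPresheaf f where
  obj U := Subring.closure (generators D U)
  map_mem {U V} h t ht := by
    have : Subring.closure (generators D V) ≤
        (Subring.closure (generators D U)).comap (res (f.preimage_mono h)) := by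
      rw [Subring.closure_le]
      rintro _ (⟨r, rfl⟩ | ht)
      · refine Subring.subset_closure (.inl ⟨res h r, app_res f h r⟩)
      · obtain ⟨i, hi⟩ := Set.mem_iUnion.mp ht
        exact Subring.subset_closure
          (.inr (Set.mem_iUnion.mpr ⟨i, res_mem_extensions f _ _ h _ hi⟩))
    exact this ht
  app_mem U r := Subring.subset_closure (.inl ⟨r, rfl⟩)
  isIntegralElem := isIntegralElem_of_mem_closure D
  exists_pow_mul {U} hU r t ht := by
    change ∃ n : ℕ, ∃ t' ∈ Subring.closure (generators D U),
      res (f.preimage_mono (Y.basicOpen_le r)) t' =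
        res (f.preimage_mono (Y.basicOpen_le r)) (f.app U r) ^ n * t
    have hρ : f.app U r ∈ Subring.closure (generators D U) :=
      Subring.subset_closure (.inl ⟨r, rfl⟩)
    induction ht using Subring.closure_induction with
    | mem t ht =>
      obtain ⟨c, rfl⟩ | ht := ht
      · have hloc := hU.isLocalization_basicOpen r
        obtain ⟨⟨c', ⟨_, m, rfl⟩⟩, hc'⟩ := IsLocalization.surj (Submonoid.powers r) c
        have hc' : c * res (Y.basicOpen_le r) (r ^ m) = res (Y.basicOpen_le r) c' := hc'
        refine ⟨m, f.app U c', Subring.subset_closure (.inl ⟨c', rfl⟩), ?_⟩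
        rw [← app_res f (Y.basicOpen_le r) c', ← hc', ← app_res f (Y.basicOpen_le r) r, map_mul,
          map_pow, map_pow, mul_comm]
      · obtain ⟨i, hi⟩ := Set.mem_iUnion.mp ht
        have := (D i).compactSpace
        obtain ⟨n, t', ht', h⟩ := exists_extensions_res_eq f _ _ hU r t hi
        exact ⟨n, t', Subring.subset_closure (.inr (Set.mem_iUnion.mpr ⟨i, ht'⟩)), h⟩
    | zero => exact ⟨0, 0, zero_mem _, by simp⟩
    | one => exact ⟨0, 1, one_mem _, by simp⟩
    | add a b _ _ ha hb =>
      obtain ⟨n, a', ha', ha⟩ := ha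
      obtain ⟨m, b', hb', hb⟩ := hb
      refine ⟨n + m, f.app U r ^ m * a' + f.app U r ^ n * b',
        add_mem (mul_mem (pow_mem hρ m) ha') (mul_mem (pow_mem hρ n) hb'), ?_⟩
      rw [map_add, map_mul, map_mul, ha, hb, map_pow, map_pow]
      ring
    | neg a _ ha =>
      obtain ⟨n, a', ha', ha⟩ := ha
      exact ⟨n, -a', neg_mem ha', by rw [map_neg, ha, mul_neg]⟩
    | mul a b _ _ ha hb =>
      obtain ⟨n, a', ha', ha⟩ := ha
      obtain ⟨m, b', hb', hb⟩ := hb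
      refine ⟨n + m, a' * b', mul_mem ha' hb', ?_⟩
      rw [map_mul, ha, hb]
      ring

theorem mem_subringPresheaf [IsNoetherian X] [QuasiSeparated f] (i : ι) :
    (D i).s ∈ (subringPresheaf D).obj (D i).V :=
  Subring.subset_closure (.inr (Set.mem_iUnion.mpr
    ⟨i, self_mem_extensions f _ _ (D i).isIntegralElem (D i).preimage_eq_bot⟩))

theorem exists_finite_closure_eq [Finite ι] [IsNoetherian X] [IsNoetherian Y] [QuasiSeparated f]
    {U : Y.Opens} (hU : IsAffineOpen U) : ∃ F : Set Γ(X, f ⁻¹ᵁ U), F.Finite ∧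
      (∀ t ∈ F, (f.app U).hom.IsIntegralElem t) ∧
      (subringPresheaf D).obj U = Subring.closure (Set.range (f.app U) ∪ F) := by
  choose F hF hF' hF'' using fun i ↦
    exists_finite_span_extensions f (D i).s (D i).q (D i).eq_zero hU
  refine ⟨⋃ i, F i, Set.finite_iUnion hF, ?_, le_antisymm ?_ ?_⟩
  · intro t ht
    obtain ⟨i, hi⟩ := Set.mem_iUnion.mp ht
    exact (hF' i hi).2.1
  · refine Subring.closure_le.mpr ?_
    rintro t (ht | ht)
    · exact Subring.subset_closure (.inl ht)
    · obtain ⟨i, hi⟩ := Set.mem_iUnion.mp ht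
      refine Subring.closure_mono ?_ (hF'' i t hi)
      exact Set.union_subset_union_right _ (Set.subset_iUnion F i)
  · refine Subring.closure_mono (Set.union_subset_union_right _ ?_)
    exact Set.iUnion_mono hF'

end ExtensionDatum

theorem app_appLE_of_comp_eq {X Y Z : Scheme.{u}} {i : X ⟶ Z} {h : Z ⟶ Y} {f : X ⟶ Y}
    (H : i ≫ h = f) (U : Y.Opens) (e : f ⁻¹ᵁ U ≤ i ⁻¹ᵁ h ⁻¹ᵁ U) :
    h.app U ≫ i.appLE (h ⁻¹ᵁ U) (f ⁻¹ᵁ U) e = f.app U := by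
  subst H
  exact (Scheme.Hom.comp_appLE i h U _ e).symm.trans (Scheme.Hom.app_eq_appLE ..).symm

/-- Finitely many local integral sections are generated by sections of a finite scheme over the
base. -/
theorem exists_isFinite_factorization {X Y : Scheme.{u}} [IsNoetherian X] [IsNoetherian Y]
    (f : X ⟶ Y) [QuasiSeparated f] {ι : Type*} [Finite ι] (V : ι → Y.Opens)
    (hV : ∀ i, IsAffineOpen (V i)) (S : ∀ i, Set Γ(X, f ⁻¹ᵁ V i)) (hS : ∀ i, (S i).Finite)
    (hint : ∀ i, ∀ t ∈ S i, (f.app (V i)).hom.IsIntegralElem t) :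
    ∃ (Z : Scheme.{u}) (i : X ⟶ Z) (h : Z ⟶ Y), i ≫ h = f ∧ IsFinite h ∧
    ∀ k, ∃ e : f ⁻¹ᵁ V k ≤ i ⁻¹ᵁ h ⁻¹ᵁ V k,
      Function.Injective (i.appLE (h ⁻¹ᵁ V k) (f ⁻¹ᵁ V k) e) ∧
      Set.range (f.app (V k)) ∪ S k ⊆ (i.appLE (h ⁻¹ᵁ V k) (f ⁻¹ᵁ V k) e).hom.range := by
  have hSfin : ∀ k, Finite (S k) := hS
  have hD : ∀ k : Sigma fun k ↦ S k, ∃ D : ExtensionDatum f, ∃ h : D.V = V k.1, k.2.1 = h ▸ D.s :=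
    fun k ↦ exists_extensionDatum f (V k.1) k.2.1 (hint _ _ k.2.2)
  choose D hD hD' using hD
  obtain ⟨Z, i, h, hih, H⟩ := (ExtensionDatum.subringPresheaf D).exists_factorization
  refine ⟨Z, i, h, hih, ?_, fun k ↦ ?_⟩
  · refine (isFinite_iff h).mpr ⟨⟨fun U hU ↦ (H U hU).1⟩, fun U hU ↦ ?_⟩
    obtain ⟨-, e, hinj, he⟩ := H U hU
    obtain ⟨F, hF, hF', hEF⟩ := ExtensionDatum.exists_finite_closure_eq D hU
    have hj : (i.appLE (h ⁻¹ᵁ U) (f ⁻¹ᵁ U) e).hom.comp (h.app U).hom = (f.app U).hom := by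
      rw [← CommRingCat.hom_comp]
      exact congrArg _ (app_appLE_of_comp_eq hih U e)
    refine finite_of_range_eq_closure (h.app U).hom (i.appLE (h ⁻¹ᵁ U) (f ⁻¹ᵁ U) e).hom hinj F hF ?_ ?_
    · rw [hj]
      exact hF'
    · rw [hj, he]
      exact hEF
  · obtain ⟨-, e, hinj, he⟩ := H (V k) (hV k)
    refine ⟨e, hinj, ?_⟩
    rw [he]
    rintro t (⟨r, rfl⟩ | ht)
    · exact SubringPresheaf.app_mem _ _ _
    · have h1 := ExtensionDatum.mem_subringPresheaf D ⟨k, t, ht⟩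
      -- The open set of the datum equals `V k` only propositionally, so membership is transported
      -- along that equality.
      have h2 : ∀ {W : Y.Opens} (e : W = V k) (s : Γ(X, f ⁻¹ᵁ W)),
          s ∈ (ExtensionDatum.subringPresheaf D).obj W →
          e ▸ s ∈ (ExtensionDatum.subringPresheaf D).obj (V k) := by
        rintro _ rfl s hs
        exact hs
      have h3 := h2 (hD ⟨k, t, ht⟩) _ h1
      rw [← hD' ⟨k, t, ht⟩] at h3
      exact h3

/-! ### Localizing charts cut out by finitely many integral sections. -/

/-- The subring of fractions of elements in the image of a ring homomorphism. -/
def fractionSubring {C B : Type*} [CommRing C] [CommRing B] (θ : C →+* B) : Subring B where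
  carrier := {b | ∃ c s : C, IsUnit (θ s) ∧ b * θ s = θ c}
  zero_mem' := ⟨0, 1, by simp, by simp⟩
  one_mem' := ⟨1, 1, by simp, by simp⟩
  add_mem' := by
    rintro a b ⟨c, s, hs, h⟩ ⟨c', s', hs', h'⟩
    refine ⟨c * s' + c' * s, s * s', by rw [map_mul]; exact hs.mul hs', ?_⟩
    simp only [map_add, map_mul, ← h, ← h']
    ring
  neg_mem' := by
    rintro a ⟨c, s, hs, h⟩
    exact ⟨-c, s, hs, by rw [map_neg, ← h, neg_mul]⟩
  mul_mem' := by
    rintro a b ⟨c, s, hs, h⟩ ⟨c', s', hs', h'⟩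
    refine ⟨c * c', s * s', by rw [map_mul]; exact hs.mul hs', ?_⟩
    simp only [map_mul, ← h, ← h']
    ring

theorem mem_fractionSubring_of_mul_mem {C B : Type*} [CommRing C] [CommRing B] (θ : C →+* B)
    {b t : B} (ht : t ∈ fractionSubring θ) (hu : IsUnit t) (hbt : b * t ∈ fractionSubring θ) :
    b ∈ fractionSubring θ := by
  obtain ⟨c, s, hs, h⟩ := ht
  obtain ⟨c', s', hs', h'⟩ := hbt
  refine ⟨c' * s, c * s', ?_, ?_⟩
  · rw [map_mul, ← h]
    exact (hu.mul hs).mul hs'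
  · rw [map_mul, map_mul, ← h, ← h']
    ring

theorem map_mem_fractionSubring {C B : Type*} [CommRing C] [CommRing B] (θ : C →+* B) (c : C) :
    θ c ∈ fractionSubring θ :=
  ⟨c, 1, by simp, by simp⟩

/-- The multiplicative set is the full preimage of the units; it contains the powers of `r`, and
these already kill the kernel. -/
theorem isLocalizingHom_of_fractionSubring_eq_top {C B : Type u} [CommRing C] [CommRing B]
    (θ : C →+* B) (r : C) (hr : IsUnit (θ r)) (hker : ∀ c, θ c = 0 → ∃ n : ℕ, r ^ n * c = 0)
    (h : ∀ b, b ∈ fractionSubring θ) : IsLocalizingHom θ := by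
  let _ := θ.toAlgebra
  refine ⟨(IsUnit.submonoid B).comap θ, ⟨⟨fun s ↦ s.2, fun b ↦ ?_, fun {a b} hab ↦ ?_⟩⟩⟩
  · obtain ⟨c, s, hs, hc⟩ := h b
    exact ⟨(c, ⟨s, hs⟩), hc⟩
  · obtain ⟨n, hn⟩ := hker (a - b) (by rw [map_sub]; exact sub_eq_zero.mpr hab)
    refine ⟨⟨r ^ n, ?_⟩, ?_⟩
    · change IsUnit (θ (r ^ n))
      rw [map_pow]
      exact hr.pow n
    · rw [mul_sub, sub_eq_zero] at hn
      exact hn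

/-- Around each point of an essentially finite type, quasi-finite chart, finitely many integral
sections determine the local structure. -/
theorem exists_finite_isLocalizingHom {X Y : Scheme.{u}} (f : X ⟶ Y) [IsSeparated f] [QuasiCompact f]
    {V : Y.Opens} (hV : IsAffineOpen V) {U : X.Opens} (hU : IsAffineOpen U) (hUV : U ≤ f ⁻¹ᵁ V)
    (hft : (f.appLE V U hUV).hom.EssFiniteType) (hqf : (f.appLE V U hUV).hom.QuasiFinite)
    (x : X) (hx : x ∈ U) :
    ∃ E : Set Γ(X, f ⁻¹ᵁ V), E.Finite ∧ (∀ t ∈ E, (f.app V).hom.IsIntegralElem t) ∧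
      ∃ r ∈ E, x ∈ X.basicOpen r ∧ IsAffineOpen (X.basicOpen r) ∧
        ∀ (C : Type u) [CommRing C] (j : C →+* Γ(X, f ⁻¹ᵁ V)), Function.Injective j →
          Set.range (f.app V) ∪ E ⊆ j.range →
            IsLocalizingHom ((res (X.basicOpen_le r)).comp j) := by
  obtain ⟨r₀, hr₀, hxr₀, hr₀U⟩ := exists_isIntegralElem_basicOpen_le f hV hU hUV hft hqf x hx
  have hK := f.isCompact_preimage hV.isCompact
  have hQS := f.isQuasiSeparated_preimage hV.isQuasiSeparated
  have hloc (r : Γ(X, f ⁻¹ᵁ V)) (b : Γ(X, X.basicOpen r)) :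
      ∃ (n : ℕ) (g : Γ(X, f ⁻¹ᵁ V)), b * res (X.basicOpen_le r) r ^ n = res (X.basicOpen_le r) g := by
    have := isLocalization_basicOpen_of_qcqs hK hQS r
    obtain ⟨⟨g, ⟨_, n, rfl⟩⟩, h⟩ := IsLocalization.surj (Submonoid.powers r) b
    refine ⟨n, g, ?_⟩
    rw [← map_pow]
    exact h
  obtain ⟨F, hF⟩ : ∃ F : Finset Γ(X, U), ∀ b : Γ(X, U), ∃ t, IsUnit t ∧
      t ∈ Subring.closure (Set.range (f.appLE V U hUV) ∪ F) ∧
      b * t ∈ Subring.closure (Set.range (f.appLE V U hUV) ∪ F) := by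
    let _ := (f.appLE V U hUV).hom.toAlgebra
    obtain ⟨F, hF⟩ := (Algebra.essFiniteType_iff Γ(Y, V) Γ(X, U)).mp hft
    refine ⟨F, fun b ↦ ?_⟩
    obtain ⟨t, ht, hu, hbt⟩ := hF b
    exact ⟨t, hu, Algebra.mem_adjoin_iff.mp ht, Algebra.mem_adjoin_iff.mp hbt⟩
  classical
  -- `γ b` is a global numerator of `b` on the basic open of `r₀`, and `s b` makes it integral.
  choose n γ hγ using fun b : Γ(X, U) ↦ hloc r₀ (res hr₀U b)
  choose s hs hsγ hxs using fun b : Γ(X, U) ↦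
    exists_isIntegralElem_mul f hV hU hUV hft hqf x hx (γ b)
  let r := r₀ * ∏ b ∈ F, s b
  have hprod : (f.app V).hom.IsIntegralElem (∏ b ∈ F, s b) ∧ x ∈ X.basicOpen (∏ b ∈ F, s b) := by
    refine Finset.prod_induction s
      (fun t ↦ (f.app V).hom.IsIntegralElem t ∧ x ∈ X.basicOpen t) ?_ ?_ fun b _ ↦ ⟨hs b, hxs b⟩
    · rintro a b ⟨ha, ha'⟩ ⟨hb, hb'⟩
      refine ⟨ha.mul _ hb, ?_⟩
      rw [Scheme.basicOpen_mul]
      exact ⟨ha', hb'⟩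
    · refine ⟨(f.app V).hom.isIntegralElem_one, ?_⟩
      rw [Scheme.basicOpen_of_isUnit _ isUnit_one]
      exact hUV hx
  have hxr : x ∈ X.basicOpen r := by
    rw [Scheme.basicOpen_mul]
    exact ⟨hxr₀, hprod.2⟩
  have hrr₀ : X.basicOpen r ≤ X.basicOpen r₀ := by
    rw [Scheme.basicOpen_mul]
    exact inf_le_left
  have hrU := hrr₀.trans hr₀U
  refine ⟨{r, r₀} ∪ (s '' F ∪ (fun b ↦ s b * γ b) '' F),
    (Set.toFinite _).union ((F.finite_toSet.image _).union (F.finite_toSet.image _)), ?_, r,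
    .inl (.inl rfl), hxr, ?_, ?_⟩
  · rintro t ((rfl | rfl) | (⟨b, -, rfl⟩ | ⟨b, -, rfl⟩))
    · exact hr₀.mul _ hprod.1
    · exact hr₀
    · exact hs b
    · exact hsγ b
  · have h1 : X.basicOpen (res hUV r) = X.basicOpen r := by
      rw [basicOpen_res]
      exact inf_eq_right.mpr hrU
    rw [← h1]
    exact hU.basicOpen _
  · intro C _ j hj hjE
    have hle := X.basicOpen_le r
    let θ := (res hle).comp j
    obtain ⟨ρ, hρ⟩ := hjE (.inr (.inl (.inl rfl)))
    have hu : IsUnit (res hle r) := RingedSpace.isUnit_res_basicOpen _ r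
    have hdvd (a b : Γ(X, f ⁻¹ᵁ V)) (hab : a * b = r) : IsUnit (res hle a) := by
      have h1 : res hle a * res hle b = res hle r := by
        rw [← map_mul]
        exact congrArg _ hab
      exact isUnit_of_mul_isUnit_left (h1 ▸ hu)
    have hB (b : Γ(X, U)) : res hrU b ∈ fractionSubring θ := by
      have key : (Subring.closure (Set.range (f.appLE V U hUV) ∪ F)) ≤
          (fractionSubring θ).comap (res hrU) := by
        refine Subring.closure_le.mpr ?_
        rintro _ (⟨a, rfl⟩ | hb)
        · obtain ⟨c, hc⟩ := hjE (.inl ⟨a, rfl⟩)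
          have : res hrU (f.appLE V U hUV a) = θ c := by
            rw [RingHom.comp_apply, hc, Scheme.Hom.appLE, CommRingCat.comp_apply]
            exact res_res hrU hUV _
          exact Subring.mem_comap.mpr (this ▸ map_mem_fractionSubring θ c)
        · rename_i b
          obtain ⟨c, hc⟩ := hjE (.inr (.inr (.inr ⟨b, hb, rfl⟩)))
          obtain ⟨c', hc'⟩ := hjE (.inr (.inr (.inl ⟨b, hb, rfl⟩)))
          obtain ⟨ρ₀, hρ₀⟩ := hjE (.inr (.inl (.inr rfl)))
          -- On the basic open of `r`, `b = (s b * γ b) / (r₀ ^ n b * s b)`. The denominator is a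
          -- unit there because `r₀` and `s b` divide `r`.
          refine ⟨c, ρ₀ ^ n b * c', ?_, ?_⟩
          · rw [map_mul, map_pow]
            refine IsUnit.mul (IsUnit.pow _ ?_) ?_
            · rw [RingHom.comp_apply, hρ₀]
              exact hdvd _ _ rfl
            · rw [RingHom.comp_apply, hc']
              refine hdvd _ (r₀ * ∏ b ∈ F.erase b, s b) ?_
              rw [mul_left_comm, Finset.mul_prod_erase F s hb]
          · simp only [θ, RingHom.comp_apply, map_mul, map_pow, hρ₀, hc, hc']
            have h1 := congr(res hrr₀ $(hγ b))
            simp only [map_mul, map_pow, res_res] at h1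
            rw [← h1]
            ring
      obtain ⟨t, ht, ht', hbt⟩ := hF b
      refine mem_fractionSubring_of_mul_mem θ (key ht') (ht.map _) ?_
      rw [← map_mul]
      exact key hbt
    refine isLocalizingHom_of_fractionSubring_eq_top θ ρ ?_ ?_ ?_
    · rw [RingHom.comp_apply, hρ]
      exact hu
    · intro c hc
      obtain ⟨n, hn⟩ := exists_pow_mul_eq_zero_of_res_eq_zero hK r (j c) rfl hle hc
      refine ⟨n, hj ?_⟩
      rw [map_mul, map_pow, hρ, hn, map_zero]
    · intro b
      obtain ⟨n, g, hg⟩ := hloc r b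
      -- A section over the basic open of `r` is `g / r ^ n` with `g` defined on `f⁻¹ V`. Its
      -- numerator restricts through `U`, so it is covered by `hB`.
      refine mem_fractionSubring_of_mul_mem θ (t := res hle r ^ n) ?_ (hu.pow n) ?_
      · have : θ ρ = res hle r := congrArg (res hle) hρ
        exact this ▸ pow_mem (map_mem_fractionSubring θ ρ) n
      · rw [hg, ← res_res hrU hUV]
        exact hB _

theorem IsEssQuasiFinite.locallyQuasiFinite {X Y : Scheme.{u}} {f : X ⟶ Y}
    (hf : IsEssQuasiFinite f) : LocallyQuasiFinite f := by
  refine LocallyQuasiFinite.of_fiberToSpecResidueField f fun y ↦ ?_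
  obtain ⟨A, φ, e, hφ, he⟩ := hf.fiber y
  have : IsFinite (Spec.map φ) := (IsFinite.SpecMap_iff φ).mpr hφ
  rw [← he]
  infer_instance

/-- The preimage of a suitable affine open is covered by finitely many charts which are
determined by finitely many integral sections. -/
theorem exists_finite_isLocalizingHom_cover {X Y : Scheme.{u}} (f : X ⟶ Y) [IsSeparated f]
    [QuasiCompact f] [LocallyQuasiFinite f] {V : Y.Opens} (hV : IsAffineOpen V)
    (s : Set X.Opens) (hs : sSup s = f ⁻¹ᵁ V)
    (hsU : ∀ U ∈ s, IsAffineOpen U ∧ ∃ e : U ≤ f ⁻¹ᵁ V, (f.appLE V U e).hom.EssFiniteType) :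
    ∃ S : Set Γ(X, f ⁻¹ᵁ V), S.Finite ∧ (∀ t ∈ S, (f.app V).hom.IsIntegralElem t) ∧
      ∃ T ⊆ S, (∀ x ∈ f ⁻¹ᵁ V, ∃ r ∈ T, x ∈ X.basicOpen r) ∧
        (∀ r ∈ T, IsAffineOpen (X.basicOpen r)) ∧
        ∀ (C : Type u) [CommRing C] (j : C →+* Γ(X, f ⁻¹ᵁ V)), Function.Injective j →
          Set.range (f.app V) ∪ S ⊆ j.range →
            ∀ r ∈ T, IsLocalizingHom ((res (X.basicOpen_le r)).comp j) := by
  have key : ∀ x : f ⁻¹ᵁ V, ∃ E : Set Γ(X, f ⁻¹ᵁ V), E.Finite ∧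
      (∀ t ∈ E, (f.app V).hom.IsIntegralElem t) ∧
      ∃ r ∈ E, x.1 ∈ X.basicOpen r ∧ IsAffineOpen (X.basicOpen r) ∧
        ∀ (C : Type u) [CommRing C] (j : C →+* Γ(X, f ⁻¹ᵁ V)), Function.Injective j →
          Set.range (f.app V) ∪ E ⊆ j.range →
            IsLocalizingHom ((res (X.basicOpen_le r)).comp j) := by
    intro x
    obtain ⟨U, hUs, hxU⟩ := Opens.mem_sSup.mp (hs.ge x.2)
    obtain ⟨hU, e, hft⟩ := hsU U hUs
    exact exists_finite_isLocalizingHom f hV hU e hft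
      (LocallyQuasiFinite.quasiFinite_appLE hV hU e) x.1 hxU
  choose E hE hE' r hrE hxr hr H using key
  obtain ⟨t, ht⟩ := (f.isCompact_preimage hV.isCompact).elim_finite_subcover
    (fun x : f ⁻¹ᵁ V ↦ (X.basicOpen (r x) : Set X)) (fun x ↦ (X.basicOpen (r x)).2)
    (fun x hx ↦ Set.mem_iUnion.mpr ⟨⟨x, hx⟩, hxr ⟨x, hx⟩⟩)
  refine ⟨⋃ x ∈ t, E x, t.finite_toSet.biUnion fun x _ ↦ hE x, ?_, r '' t, ?_, ?_, ?_, ?_⟩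
  · intro a ha
    obtain ⟨x, -, hx⟩ := Set.mem_iUnion₂.mp ha
    exact hE' x a hx
  · rintro _ ⟨x, hx, rfl⟩
    exact Set.mem_iUnion₂.mpr ⟨x, hx, hrE x⟩
  · intro x hx
    obtain ⟨x', hx', hxx'⟩ := Set.mem_iUnion₂.mp (ht hx)
    exact ⟨r x', ⟨x', hx', rfl⟩, hxx'⟩
  · rintro _ ⟨x, -, rfl⟩
    exact hr x
  · rintro C _ j hj hjE _ ⟨x, hx, rfl⟩
    refine H x C j hj ((Set.union_subset_union_right _ ?_).trans hjE)
    exact Set.subset_biUnion_of_mem (u := fun x ↦ E x) hx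

theorem injOn_of_isLocalizingHom_appLE {X Z : Scheme.{u}} (i : X ⟶ Z) {U : X.Opens} {W : Z.Opens}
    (hU : IsAffineOpen U) (hW : IsAffineOpen W) (e : U ≤ i ⁻¹ᵁ W)
    (h : IsLocalizingHom (i.appLE W U e).hom) : Set.InjOn i U := by
  obtain ⟨S, hS⟩ := h
  let _ := (i.appLE W U e).hom.toAlgebra
  have h1 : Function.Injective (Spec.map (i.appLE W U e)) :=
    PrimeSpectrum.localization_comap_injective Γ(X, U) S
  have h2 : Function.Injective hW.fromSpec := hW.fromSpec.isOpenEmbedding.injective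
  intro x hx y hy hxy
  have h3 (x : U) : hW.fromSpec (Spec.map (i.appLE W U e) (hU.primeIdealOf x)) = i x.1 := by
    refine (Scheme.Hom.comp_apply _ _ _).symm.trans ?_
    rw [IsAffineOpen.SpecMap_appLE_fromSpec i hW hU e]
    refine (Scheme.Hom.comp_apply _ _ _).trans ?_
    exact congr(i $(hU.fromSpec_primeIdealOf x))
  have h4 : hU.primeIdealOf ⟨x, hx⟩ = hU.primeIdealOf ⟨y, hy⟩ := by
    refine h1 (h2 ?_)
    rw [h3, h3]
    exact hxy
  have h5 := congr(hU.fromSpec $h4)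
  rwa [hU.fromSpec_primeIdealOf, hU.fromSpec_primeIdealOf] at h5

end EssZMT

/-! ### Assembly of the factorization. -/

theorem mainTheorem5 {X Y : Scheme.{u}} [AlgebraicGeometry.IsNoetherian X]
    [AlgebraicGeometry.IsNoetherian Y] (f : X ⟶ Y) [IsSeparated f]
    (hf : EssZMT.IsEssQuasiFinite f) :
    ∃ (Z : Scheme.{u}) (i : X ⟶ Z) (h : Z ⟶ Y), AlgebraicGeometry.IsNoetherian Z ∧
      EssZMT.IsLocalizingImmersion i ∧ IsFinite h ∧ i ≫ h = f := by
  have := hf.locallyQuasiFinite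
  choose V hV hyV s hs hsV hsU using hf.isEssFiniteType
  choose S hS hint T hTS hcov hTaff H using fun y ↦
    EssZMT.exists_finite_isLocalizingHom_cover f (hV y) (s y) (hsV y) (hsU y)
  obtain ⟨t, ht⟩ := isCompact_univ.elim_finite_subcover (fun y : Y ↦ (V y : Set Y))
    (fun y ↦ (V y).2) (fun y _ ↦ Set.mem_iUnion.mpr ⟨y, hyV y⟩)
  obtain ⟨Z, i, h, hih, hfin, hZ⟩ := EssZMT.exists_isFinite_factorization f (ι := t)
    (fun y ↦ V y.1) (fun y ↦ hV y.1) (fun y ↦ S y.1) (fun y ↦ hS y.1) (fun y ↦ hint y.1)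
  have hloc (y : t) (r : Γ(X, f ⁻¹ᵁ V y.1)) (hr : r ∈ T y.1) :
      ∃ e : X.basicOpen r ≤ i ⁻¹ᵁ h ⁻¹ᵁ V y.1,
        EssZMT.IsLocalizingHom (i.appLE (h ⁻¹ᵁ V y.1) (X.basicOpen r) e).hom := by
    obtain ⟨e, hinj, hr'⟩ := hZ y
    refine ⟨(X.basicOpen_le r).trans e, ?_⟩
    have h1 := H y.1 _ (i.appLE (h ⁻¹ᵁ V y.1) (f ⁻¹ᵁ V y.1) e).hom hinj hr' r hr
    have h2 : i.appLE (h ⁻¹ᵁ V y.1) (f ⁻¹ᵁ V y.1) e ≫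
        X.presheaf.map (homOfLE (X.basicOpen_le r)).op =
          i.appLE (h ⁻¹ᵁ V y.1) (X.basicOpen r) ((X.basicOpen_le r).trans e) :=
      Scheme.Hom.appLE_map ..
    rw [← h2]
    exact h1
  have hcovY (y : Y) : ∃ k : t, y ∈ V k.1 := by
    obtain ⟨k, hk, hy⟩ := Set.mem_iUnion₂.mp (ht (Set.mem_univ y))
    exact ⟨⟨k, hk⟩, hy⟩
  have hpre (U : Y.Opens) : i ⁻¹ᵁ h ⁻¹ᵁ U = f ⁻¹ᵁ U := by
    rw [← Scheme.Hom.comp_preimage, hih]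
  refine ⟨Z, i, h, ?_, ⟨fun z ↦ ?_, fun x x' hxx' ↦ ?_⟩, hfin, hih⟩
  · have h1 : IsLocallyNoetherian Z := LocallyOfFiniteType.isLocallyNoetherian h
    have h2 : CompactSpace Z := QuasiCompact.compactSpace_of_compactSpace h
    exact { }
  · obtain ⟨k, hk⟩ := hcovY (h z)
    refine ⟨h ⁻¹ᵁ V k.1, (hV k.1).preimage h, hk, X.basicOpen '' T k.1,
      ((hS k.1).subset (hTS k.1)).image _, ?_, ?_⟩
    · rw [hpre]
      refine le_antisymm (sSup_le ?_) fun x hx ↦ ?_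
      · rintro _ ⟨r, -, rfl⟩
        exact X.basicOpen_le r
      · obtain ⟨r, hr, hxr⟩ := hcov k.1 x hx
        exact TopologicalSpace.Opens.mem_sSup.mpr ⟨_, ⟨r, hr, rfl⟩, hxr⟩
    · rintro _ ⟨r, hr, rfl⟩
      exact ⟨hTaff k.1 r hr, hloc k r hr⟩
  · obtain ⟨k, hk⟩ := hcovY (h (i x))
    have hx : x ∈ f ⁻¹ᵁ V k.1 := (hpre _).le hk
    have hx' : x' ∈ f ⁻¹ᵁ V k.1 := by
      rw [hxx'] at hk
      exact (hpre _).le hk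
    obtain ⟨r, hr, hxr⟩ := hcov k.1 x hx
    obtain ⟨e, he⟩ := hloc k r hr
    refine EssZMT.injOn_of_isLocalizingHom_appLE i (hTaff k.1 r hr) ((hV k.1).preimage h) e he hxr ?_
      hxx'
    -- It remains to put `x'` in the chart of `x`. Since `r` is the pullback of a section `c` of
    -- `Z`, membership in the basic open of `r` depends, within `f⁻¹ V k`, only on the image in `Z`.
    obtain ⟨e', -, hr'⟩ := hZ k
    obtain ⟨c, hc⟩ := hr' (.inr (hTS k.1 hr))
    have hbo : X.basicOpen r = f ⁻¹ᵁ V k.1 ⊓ i ⁻¹ᵁ Z.basicOpen c := by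
      rw [← hc]
      exact Scheme.basicOpen_appLE ..
    rw [hbo] at hxr ⊢
    refine ⟨hx', ?_⟩
    have h1 : i x ∈ Z.basicOpen c := hxr.2
    rw [hxx'] at h1
    exact h1
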